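/- Let $\Lambda=(-1,1)$, $\omega^{(a,b)}(x)=(1-x)^a(1+x)^b$, and let $L^2_{\omega^{(a,b)}}(\Lambda)$ be the weighted space of real functions with inner product $(f,g)_{\omega^{(a,b)}}=\int_\Lambda f g\,\omega^{(a,b)}\,dx$ and norm $\|\cdot\|_{\omega^{(a,b)}}$. Let $\mathcal P_N$ be the real polynomials of degree at most $N$. For $s\ge 0$ and $k=\lfloor s\rfloor+1$, the right-sided Riemann–Liouville derivative of a function $v$ that is integrable on $(x,1)$ for every $x\in\Lambda$ is $$D_+^s v(x)=\frac{(-1)^k}{\Gamma(k-s)}\,\frac{d^k}{dx^k}\int_x^1\frac{v(y)}{(y-x)^{s-k+1}}\,dy,$$ where $d^k/dx^k$ is the weak derivative on $\Lambda$. Let $\alpha>0$, $-\alpha-1<\beta<-1$ and $-\beta\notin\mathbb N$. For $u$ with $D_+^\alpha u\in L^2_{\omega^{(0,\alpha+\beta)}}(\Lambda)$, let $\pi_N u$ be the unique element of $\{(1-x)^\alpha\psi:\psi\in\mathcal P_N\}$ with $D_+^\alpha(\pi_N u)=\Pi_N^{(0,\alpha+\beta)}(D_+^\alpha u)$, where $\Pi_N^{(0,\alpha+\beta)}$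 is the $L^2_{\omega^{(0,\alpha+\beta)}}$-orthogonal projection onto $\mathcal P_N$; such an element exists and is unique. Let $0\le m\le N$ be integers and suppose that $D_+^{\alpha+l}u\in L^2_{\omega^{(l,\alpha+\beta+l)}}(\Lambda)$ for all integers $0\le l\le m$. Then $D_+^\alpha(\pi_N u-u)\in L^2_{\omega^{(0,\alpha+\beta)}}(\Lambda)$ and $$\big\|D_+^\alpha(\pi_N u-u)\big\|_{\omega^{(0,\alpha+\beta)}}\le N^{-m/2}\sqrt{\frac{(N-m+1)!}{(N+1)!}}\;\big\|D_+^{\alpha+m}u\big\|_{\omega^{(m,\alpha+\beta+m)}}$$ (with $0^0=1$). In particular, for each fixed $m$ there are constants $c_N$, depending only on $m$ and $N$, with $c_N\to1$ as $N\to\infty$, such that for all such $\alpha,\beta,u$ and all $N\ge m$ $$\big\|D_+^\alpha(\pi_N u-u)\big\|_{\omega^{(0,\alpha+\beta)}}\le c_N\,N^{-m}\,\big\|D_+^{\alpha+m}u\big\|_{\omega^{(m,\alpha+\beta+m)}}.$$ -/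

import Mathlib

noncomputable section

namespace GJF

/-- The open interval `Λ = (-1, 1)`. -/
def Lam : Set ℝ := Set.Ioo (-1) 1

/-- The Jacobi weight `ω^{(a,b)}(x) = (1 - x)^a (1 + x)^b`. -/
def weight (a b x : ℝ) : ℝ := (1 - x) ^ a * (1 + x) ^ b

/-- Membership in the weighted space `L²_{ω^{(a,b)}}(Λ)`. -/
def MemL2 (a b : ℝ) (f : ℝ → ℝ) : Prop :=
  MeasureTheory.AEStronglyMeasurable f (MeasureTheory.volume.restrict Lam) ∧
    MeasureTheory.IntegrableOn (fun x => f x ^ 2 * weight a b x) Lam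

/-- The inner product `(f, g)_{ω^{(a,b)}}`. -/
def innerW (a b : ℝ) (f g : ℝ → ℝ) : ℝ := ∫ x in Lam, f x * g x * weight a b x

/-- The norm `‖f‖_{ω^{(a,b)}}`. -/
def normW (a b : ℝ) (f : ℝ → ℝ) : ℝ := Real.sqrt (innerW a b f f)

/-- The right fractional integral `I_+^ρ v(x) = Γ(ρ)⁻¹ ∫_x^1 v(y) (y - x)^{ρ-1} dy`. -/
def rightInt (ρ : ℝ) (v : ℝ → ℝ) (x : ℝ) : ℝ :=
  (Real.Gamma ρ)⁻¹ * ∫ y in Set.Ioo x 1, v y * (y - x) ^ (ρ - 1)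

/-- `f` is the right-sided Riemann-Liouville derivative `(-1)^k D^k I_+^{k-s} v` of order `s ≥ 0`
on `Λ`, where `k = ⌊s⌋ + 1` and `D^k` is the weak (distributional) derivative on `Λ`; the two
factors `(-1)^k`, one from the definition and one from moving `D^k` onto the test function,
cancel. The first clause says that `v` is integrable up to the endpoint `1`, which is what makes
`I_+^{k-s} v` exist almost everywhere on `Λ` (as a locally integrable function). -/
def HasRightRL (s : ℝ) (v f : ℝ → ℝ) : Prop :=
  (∀ x ∈ Lam, MeasureTheory.IntegrableOn v (Set.Ioo x 1)) ∧
  MeasureTheory.LocallyIntegrableOn f Lam ∧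
  ∀ φ : ℝ → ℝ, ContDiff ℝ (⊤ : ℕ∞) φ → HasCompactSupport φ → tsupport φ ⊆ Lam →
    ∫ x in Lam, f x * φ x =
      ∫ x in Lam, rightInt ((⌊s⌋₊ : ℝ) + 1 - s) v x * iteratedDeriv (⌊s⌋₊ + 1) φ x

/-- The right-sided Riemann-Liouville derivative `D_+^s v`, a function determined up to equality
almost everywhere on `Λ` whenever it exists. -/
def rightRL (s : ℝ) (v : ℝ → ℝ) : ℝ → ℝ := Classical.epsilon (HasRightRL s v)

/-- `D_+^s v` exists and belongs to `L²_{ω^{(a,b)}}(Λ)`. -/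
def RightRLMemL2 (s a b : ℝ) (v : ℝ → ℝ) : Prop :=
  (∃ f, HasRightRL s v f) ∧ MemL2 a b (rightRL s v)

/-- The space `F_N = {(1 - x)^α ψ : ψ a real polynomial of degree at most N}`. -/
def fracPoly (α : ℝ) (N : ℕ) : Set (ℝ → ℝ) :=
  {w | ∃ ψ : Polynomial ℝ, ψ.natDegree ≤ N ∧ w = fun x => (1 - x) ^ α * ψ.eval x}

/-- The polynomial `p` is the `L²_{ω^{(a,b)}}`-orthogonal projection `Π_N^{(a,b)} f` of `f` onto
the polynomials of degree at most `N`. -/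
def IsPolyProj (a b : ℝ) (N : ℕ) (f : ℝ → ℝ) (p : Polynomial ℝ) : Prop :=
  p.natDegree ≤ N ∧ ∀ q : Polynomial ℝ, q.natDegree ≤ N →
    innerW a b (fun x => p.eval x - f x) (fun x => q.eval x) = 0

/-- `w = π_N u`: `w` belongs to `F_N` and `D_+^α w = Π_N^{(0,α+β)} (D_+^α u)`. -/
def IsFracProj (α β : ℝ) (N : ℕ) (u w : ℝ → ℝ) : Prop :=
  w ∈ fracPoly α N ∧ ∃ p : Polynomial ℝ,
    IsPolyProj 0 (α + β) N (rightRL α u) p ∧ HasRightRL α w (fun x => p.eval x)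

end GJF

end

noncomputable section

namespace GJF

open MeasureTheory Set Filter Topology

/-! ### Beta integrals -/

/-! Write g_l = D_+^{α+l} u and γ = α+β > -1. Raising the order by one keeps the same fractional
integral and adds one weak derivative, so g_{l+1} = -g_l' weakly (`HasRightRL.isWeakNegDeriv`), and
the claim becomes a statement about Jacobi-weighted polynomial approximation of g_0.

Its engine is integration by parts without boundary terms, (h', r)_{(a+1,b+1)} = -(h, A r)_{(a,b)},
where A = `jacobiAdj` raises degree by at most one (`IsWeakNegDeriv.innerW_eq`). Hence if p is the
projection of g_l of degree at most n+1, then -p' is the projection of g_{l+1} of degree at most n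
in the next weight. The same identity, with A(q') = -λ_n q + (lower degree) for q of degree n and
λ_n = n(n+a+b+1), gives a Poincaré inequality λ_{N+1}‖h‖² ≤ ‖h'‖² for h orthogonal to polynomials of
degree at most N (`IsWeakNegDeriv.jacobiEig_mul_innerW_le`).

Applied m times, with (a,b) = (j, γ+j) and degree N-j, this gives the eigenvalues (N-j+1)(N+j+2+γ) ≥
N(N+1-j), whose product yields N^m (N+1)!/(N-m+1)!. The last projection error is at most ‖g_m‖.

Existence and uniqueness of π_N u hold because, in powers of 1-x, ψ ↦ D_+^α((1-x)^α ψ) is diagonal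
with nonzero entries. -/

theorem integral_beta_scaled {s t a : ℝ} (hs : 0 < s) (ht : 0 < t) (ha : 0 < a) :
    ∫ x in (0 : ℝ)..a, x ^ (s - 1) * (a - x) ^ (t - 1) =
      a ^ (s + t - 1) * (Real.Gamma s * Real.Gamma t / Real.Gamma (s + t)) := by
  have h := Complex.betaIntegral_scaled (s : ℂ) (t : ℂ) ha
  rw [Complex.betaIntegral_eq_Gamma_mul_div _ _ (by simpa) (by simpa)] at h
  apply Complex.ofReal_injective
  rw [← intervalIntegral.integral_ofReal]
  have e : ∫ x in (0 : ℝ)..a, ((x ^ (s - 1) * (a - x) ^ (t - 1) : ℝ) : ℂ) =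
      ∫ x in (0 : ℝ)..a, (x : ℂ) ^ ((s : ℂ) - 1) * ((a : ℂ) - x) ^ ((t : ℂ) - 1) := by
    apply intervalIntegral.integral_congr
    intro x hx
    rw [uIcc_of_le ha.le] at hx
    simp only
    push_cast
    rw [Complex.ofReal_cpow hx.1, Complex.ofReal_cpow (by linarith [hx.2])]
    push_cast
    rfl
  rw [e, h]
  push_cast
  rw [Complex.ofReal_cpow ha.le, Complex.Gamma_ofReal, Complex.Gamma_ofReal, ← Complex.ofReal_add,
    Complex.Gamma_ofReal]
  push_cast
  rfl

theorem integral_one_sub_rpow_mul {σ ρ x : ℝ} (hσ : -1 < σ) (hρ : 0 < ρ) (hx : x < 1) :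
    ∫ y in Ioo x 1, (1 - y) ^ σ * (y - x) ^ (ρ - 1) =
      (1 - x) ^ (σ + ρ) * (Real.Gamma ρ * Real.Gamma (σ + 1) / Real.Gamma (σ + ρ + 1)) := by
  have h := integral_beta_scaled hρ (t := σ + 1) (by linarith) (a := 1 - x) (by linarith)
  have e := intervalIntegral.integral_comp_sub_right
    (fun z : ℝ => z ^ (ρ - 1) * (1 - x - z) ^ (σ + 1 - 1)) (a := x) (b := 1) x
  rw [sub_self] at e
  rw [← integral_Ioc_eq_integral_Ioo, ← intervalIntegral.integral_of_le hx.le]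
  rw [← e] at h
  convert h using 1
  · congr 1
    ext y
    rw [mul_comm]
    congr 2 <;> ring
  · rw [show ρ + (σ + 1) = σ + ρ + 1 by ring, add_sub_cancel_right]

/-- The integral of a non-integrable function is 0 by convention, while the Beta value is positive.
-/
theorem integrableOn_one_sub_rpow_mul {σ ρ x : ℝ} (hσ : -1 < σ) (hρ : 0 < ρ) (hx : x < 1) :
    IntegrableOn (fun y => (1 - y) ^ σ * (y - x) ^ (ρ - 1)) (Ioo x 1) := by
  by_contra hn
  have h := integral_one_sub_rpow_mul hσ hρ hx
  rw [integral_undef hn] at h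
  have h1 := Real.rpow_pos_of_pos (sub_pos.2 hx) (σ + ρ)
  have h2 := Real.Gamma_pos_of_pos hρ
  have h3 := Real.Gamma_pos_of_pos (show 0 < σ + 1 by linarith)
  have h4 := Real.Gamma_pos_of_pos (show 0 < σ + ρ + 1 by linarith)
  have : 0 < (1 - x) ^ (σ + ρ) *
    (Real.Gamma ρ * Real.Gamma (σ + 1) / Real.Gamma (σ + ρ + 1)) := by positivity
  linarith

/-! ### The weighted spaces -/

theorem measurableSet_Lam : MeasurableSet Lam := measurableSet_Ioo

theorem isOpen_Lam : IsOpen Lam := isOpen_Ioo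

theorem weight_pos {a b x : ℝ} (hx : x ∈ Lam) : 0 < weight a b x := by
  have h1 : 0 < 1 - x := by linarith [hx.2]
  have h2 : 0 < 1 + x := by linarith [hx.1]
  unfold weight
  positivity

theorem measurable_weight (a b : ℝ) : Measurable (weight a b) := by
  unfold weight
  fun_prop

theorem integrableOn_weight {a b : ℝ} (ha : -1 < a) (hb : -1 < b) :
    IntegrableOn (weight a b) Lam := by
  have := integrableOn_one_sub_rpow_mul ha (ρ := b + 1) (x := -1) (by linarith) (by norm_num)
  refine this.congr_fun (fun y _ => ?_) measurableSet_Ioo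
  simp only [weight]
  congr 2 <;> ring

theorem weight_add_one {a b x : ℝ} (hx : x ∈ Lam) :
    weight (a + 1) (b + 1) x = (1 - x ^ 2) * weight a b x := by
  have h1 : 0 < 1 - x := by linarith [hx.2]
  have h2 : 0 < 1 + x := by linarith [hx.1]
  unfold weight
  rw [Real.rpow_add_one h1.ne', Real.rpow_add_one h2.ne']
  ring

/-- The measure `ω^{(a,b)} dx` on `Λ`. -/
def weightMeasure (a b : ℝ) : Measure ℝ :=
  (volume.restrict Lam).withDensity fun x => ENNReal.ofReal (weight a b x)

theorem integrable_weightMeasure_iff {a b : ℝ} {f : ℝ → ℝ} :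
    Integrable f (weightMeasure a b) ↔ IntegrableOn (fun x => f x * weight a b x) Lam := by
  unfold weightMeasure
  rw [integrable_withDensity_iff_integrable_smul' (measurable_weight a b).ennreal_ofReal
    (by simp)]
  refine integrable_congr ?_
  filter_upwards [ae_restrict_mem measurableSet_Lam] with x hx
  rw [ENNReal.toReal_ofReal (weight_pos hx).le, smul_eq_mul, mul_comm]

theorem integral_weightMeasure {a b : ℝ} (f : ℝ → ℝ) :
    ∫ x, f x ∂(weightMeasure a b) = ∫ x in Lam, f x * weight a b x := by
  unfold weightMeasure
  rw [integral_withDensity_eq_integral_toReal_smul (measurable_weight a b).ennreal_ofReal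
    (by simp)]
  refine integral_congr_ae ?_
  filter_upwards [ae_restrict_mem measurableSet_Lam] with x hx
  rw [ENNReal.toReal_ofReal (weight_pos hx).le, smul_eq_mul, mul_comm]

theorem innerW_eq_integral {a b : ℝ} (f g : ℝ → ℝ) :
    innerW a b f g = ∫ x, f x * g x ∂(weightMeasure a b) := by
  rw [integral_weightMeasure]; rfl

theorem isFiniteMeasure_weightMeasure {a b : ℝ} (ha : -1 < a) (hb : -1 < b) :
    IsFiniteMeasure (weightMeasure a b) := by
  have : Integrable (fun _ : ℝ => (1 : ℝ)) (weightMeasure a b) := by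
    rw [integrable_weightMeasure_iff]
    simpa using integrableOn_weight ha hb
  rcases integrable_const_iff.1 this with h | h
  · norm_num at h
  · exact h

/-- The weight is positive on Λ, so Lebesgue measure on Λ and the weighted measure have the same
null sets and measurability transfers both ways. -/
theorem memL2_iff {a b : ℝ} {f : ℝ → ℝ} : MemL2 a b f ↔ MemLp f 2 (weightMeasure a b) := by
  have hac : volume.restrict Lam ≪ weightMeasure a b := by
    refine withDensity_absolutelyContinuous' (measurable_weight a b).ennreal_ofReal.aemeasurable ?_
    filter_upwards [ae_restrict_mem measurableSet_Lam] with x hx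
    simpa using weight_pos hx
  constructor
  · rintro ⟨h1, h2⟩
    refine (memLp_two_iff_integrable_sq (h1.mono_ac (withDensity_absolutelyContinuous _ _))).2 ?_
    exact integrable_weightMeasure_iff.2 h2
  · intro h
    exact ⟨h.1.mono_ac hac, integrable_weightMeasure_iff.1 h.integrable_sq⟩

theorem MemL2.sub {a b : ℝ} {f g : ℝ → ℝ} (hf : MemL2 a b f) (hg : MemL2 a b g) :
    MemL2 a b fun x => f x - g x :=
  memL2_iff.2 ((memL2_iff.1 hf).sub (memL2_iff.1 hg))

theorem MemL2.add {a b : ℝ} {f g : ℝ → ℝ} (hf : MemL2 a b f) (hg : MemL2 a b g) :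
    MemL2 a b fun x => f x + g x :=
  memL2_iff.2 ((memL2_iff.1 hf).add (memL2_iff.1 hg))

theorem MemL2.integrable_mul {a b : ℝ} {f g : ℝ → ℝ} (hf : MemL2 a b f) (hg : MemL2 a b g) :
    Integrable (fun x => f x * g x) (weightMeasure a b) :=
  MemLp.integrable_mul (memL2_iff.1 hf) (memL2_iff.1 hg)

theorem MemL2.integrableOn_mul {a b : ℝ} {f g : ℝ → ℝ} (hf : MemL2 a b f) (hg : MemL2 a b g) :
    IntegrableOn (fun x => f x * g x * weight a b x) Lam :=
  integrable_weightMeasure_iff.1 (hf.integrable_mul hg)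

theorem memL2_of_continuous {a b : ℝ} (ha : -1 < a) (hb : -1 < b) {f : ℝ → ℝ}
    (hf : Continuous f) : MemL2 a b f := by
  refine ⟨hf.aestronglyMeasurable, ?_⟩
  obtain ⟨C, hC⟩ := isCompact_Icc.exists_bound_of_continuousOn (s := Icc (-1 : ℝ) 1)
    (hf.pow 2).continuousOn
  refine Integrable.bdd_mul (c := C) (integrableOn_weight ha hb)
    (hf.pow 2).aestronglyMeasurable ?_
  filter_upwards [ae_restrict_mem measurableSet_Lam] with x hx
  exact hC x ⟨hx.1.le, hx.2.le⟩

theorem memL2_eval {a b : ℝ} (ha : -1 < a) (hb : -1 < b) (p : Polynomial ℝ) :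
    MemL2 a b fun x => p.eval x :=
  memL2_of_continuous ha hb p.continuous

theorem innerW_comm {a b : ℝ} (f g : ℝ → ℝ) : innerW a b f g = innerW a b g f := by
  simp only [innerW, mul_comm (f _)]

theorem innerW_self_nonneg {a b : ℝ} (f : ℝ → ℝ) : 0 ≤ innerW a b f f := by
  rw [innerW_eq_integral]
  exact integral_nonneg fun x => mul_self_nonneg _

theorem innerW_sub_left {a b : ℝ} {f g h : ℝ → ℝ} (hf : MemL2 a b f) (hg : MemL2 a b g)
    (hh : MemL2 a b h) :
    innerW a b (fun x => f x - g x) h = innerW a b f h - innerW a b g h := by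
  simp only [innerW_eq_integral, sub_mul]
  exact integral_sub (hf.integrable_mul hh) (hg.integrable_mul hh)

theorem innerW_add_left {a b : ℝ} {f g h : ℝ → ℝ} (hf : MemL2 a b f) (hg : MemL2 a b g)
    (hh : MemL2 a b h) :
    innerW a b (fun x => f x + g x) h = innerW a b f h + innerW a b g h := by
  simp only [innerW_eq_integral, add_mul]
  exact integral_add (hf.integrable_mul hh) (hg.integrable_mul hh)

theorem innerW_add_right {a b : ℝ} {f g h : ℝ → ℝ} (hf : MemL2 a b f) (hg : MemL2 a b g)
    (hh : MemL2 a b h) :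
    innerW a b h (fun x => f x + g x) = innerW a b h f + innerW a b h g := by
  rw [innerW_comm, innerW_add_left hf hg hh, innerW_comm f, innerW_comm g]

theorem innerW_sub_right {a b : ℝ} {f g h : ℝ → ℝ} (hf : MemL2 a b f) (hg : MemL2 a b g)
    (hh : MemL2 a b h) :
    innerW a b h (fun x => f x - g x) = innerW a b h f - innerW a b h g := by
  rw [innerW_comm, innerW_sub_left hf hg hh, innerW_comm f, innerW_comm g]

theorem innerW_const_mul_right {a b : ℝ} (c : ℝ) (f g : ℝ → ℝ) :
    innerW a b f (fun x => c * g x) = c * innerW a b f g := by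
  simp only [innerW_eq_integral, ← integral_const_mul]
  congr 1; ext x; ring

theorem innerW_const_mul_left {a b : ℝ} (c : ℝ) (f g : ℝ → ℝ) :
    innerW a b (fun x => c * f x) g = c * innerW a b f g := by
  rw [innerW_comm, innerW_const_mul_right, innerW_comm]

theorem innerW_congr {a b : ℝ} {f f' g g' : ℝ → ℝ} (hf : f =ᵐ[volume.restrict Lam] f')
    (hg : g =ᵐ[volume.restrict Lam] g') : innerW a b f g = innerW a b f' g' := by
  refine integral_congr_ae ?_
  filter_upwards [hf, hg] with x h1 h2
  rw [h1, h2]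

/-- Polynomials are dense in the weighted space. -/
theorem exists_polynomial_innerW_sub_le {a b : ℝ} (ha : -1 < a) (hb : -1 < b) {f : ℝ → ℝ}
    (hf : MemL2 a b f) {ε : ℝ} (hε : 0 < ε) :
    ∃ q : Polynomial ℝ,
      innerW a b (fun x => f x - q.eval x) (fun x => f x - q.eval x) ≤ ε := by
  have := isFiniteMeasure_weightMeasure ha hb
  set μ := weightMeasure a b with hμ
  obtain ⟨g, -, hg, hgc, -⟩ := (memL2_iff.1 hf).exists_hasCompactSupport_eLpNorm_sub_le
    (by norm_num) (ε := ENNReal.ofReal (Real.sqrt (ε / 4)))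
    (by simp; positivity)
  have hgm : MemL2 a b g := memL2_of_continuous ha hb hgc
  have hfg : innerW a b (fun x => f x - g x) (fun x => f x - g x) ≤ ε / 4 := by
    have hm := memL2_iff.1 (hf.sub hgm)
    have h2 := hm.eLpNorm_eq_integral_rpow_norm (by norm_num) (by norm_num)
    have h3 : eLpNorm (fun x => f x - g x) 2 μ ≤ ENNReal.ofReal (Real.sqrt (ε / 4)) := hg
    rw [h2, ENNReal.ofReal_le_ofReal_iff (Real.sqrt_nonneg _)] at h3
    have h4 : ∫ x, ‖f x - g x‖ ^ (2 : ENNReal).toReal ∂μ =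
        innerW a b (fun x => f x - g x) (fun x => f x - g x) := by
      rw [innerW_eq_integral]
      congr 1; ext x
      simp [← sq]
    rw [h4, Real.sqrt_eq_rpow] at h3
    refine (Real.rpow_le_rpow_iff (innerW_self_nonneg _) (by positivity)
      (z := 1 / 2) (by norm_num)).1 ?_
    simpa using h3
  set K := μ.real univ
  have hK : 0 ≤ K := measureReal_nonneg
  -- Weierstrass approximation; K + 1 instead of K keeps the denominator positive without knowing
  -- that the measure is nonzero.
  obtain ⟨q, hq⟩ := exists_polynomial_near_of_continuousOn (-1) 1 g hgc.continuousOn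
    (Real.sqrt (ε / (4 * (K + 1)))) (by positivity)
  have hqm := memL2_eval ha hb q
  have hgq : innerW a b (fun x => g x - q.eval x) (fun x => g x - q.eval x) ≤ ε / 4 := by
    rw [innerW_eq_integral]
    calc ∫ x, (g x - q.eval x) * (g x - q.eval x) ∂μ
        ≤ ∫ _, ε / (4 * (K + 1)) ∂μ := by
          refine integral_mono_ae ((hgm.sub hqm).integrable_mul (hgm.sub hqm))
            (integrable_const _) ?_
          have hmem : ∀ᵐ x ∂μ, x ∈ Lam :=
            (withDensity_absolutelyContinuous _ _).ae_le (ae_restrict_mem measurableSet_Lam)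
          filter_upwards [hmem] with x hx
          have h := hq x ⟨hx.1.le, hx.2.le⟩
          rw [abs_sub_comm, Real.lt_sqrt (abs_nonneg _), sq_abs] at h
          nlinarith
      _ = K * (ε / (4 * (K + 1))) := by simp [K]
      _ ≤ ε / 4 := by
          rw [mul_div_assoc', div_le_div_iff₀ (by positivity) (by positivity)]
          nlinarith
  refine ⟨q, ?_⟩
  have hm1 := hf.sub hgm
  have hm2 := hgm.sub hqm
  -- Nonnegativity of ‖A - B‖² gives ‖A + B‖² ≤ 2‖A‖² + 2‖B‖², hence the two bounds ε/4.
  have h5 := innerW_self_nonneg (a := a) (b := b) fun x => (f x - g x) - (g x - q.eval x)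
  have h6 : (fun x => f x - q.eval x) = fun x => (f x - g x) + (g x - q.eval x) := by
    ext x; ring
  rw [h6, innerW_add_left hm1 hm2 (hm1.add hm2), innerW_add_right hm1 hm2 hm1,
    innerW_add_right hm1 hm2 hm2]
  rw [innerW_sub_left hm1 hm2 (hm1.sub hm2), innerW_sub_right hm1 hm2 hm1,
    innerW_sub_right hm1 hm2 hm2] at h5
  linarith

/-! ### Orthogonal projection onto polynomials -/

theorem polynomial_eq_of_ae_eq {p q : Polynomial ℝ}
    (h : (fun x => p.eval x) =ᵐ[volume.restrict Lam] fun x => q.eval x) : p = q := by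
  have h1 := Measure.eqOn_open_of_ae_eq h isOpen_Lam p.continuous.continuousOn
    q.continuous.continuousOn
  exact Polynomial.eq_of_infinite_eval_eq p q
    ((Ioo_infinite (by norm_num : (-1 : ℝ) < 1)).mono fun x hx => h1 hx)

theorem innerW_eval_self_eq_zero {a b : ℝ} (ha : -1 < a) (hb : -1 < b) {p : Polynomial ℝ}
    (h : innerW a b (fun x => p.eval x) (fun x => p.eval x) = 0) : p = 0 := by
  have hp := memL2_eval ha hb p
  unfold innerW at h
  rw [integral_eq_zero_iff_of_nonneg_ae _ (hp.integrableOn_mul hp)] at h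
  · refine polynomial_eq_of_ae_eq ?_
    filter_upwards [h, ae_restrict_mem measurableSet_Lam] with x hx hx'
    have := (weight_pos (a := a) (b := b) hx').ne'
    simpa [this] using hx
  · filter_upwards [ae_restrict_mem measurableSet_Lam] with x hx
    exact mul_nonneg (mul_self_nonneg _) (weight_pos hx).le

theorem mem_degreeLT_succ_iff {N : ℕ} {p : Polynomial ℝ} :
    p ∈ Polynomial.degreeLT ℝ (N + 1) ↔ p.natDegree ≤ N := by
  rw [Polynomial.mem_degreeLT, Polynomial.degree_lt_iff_coeff_zero,
    Polynomial.natDegree_le_iff_coeff_eq_zero]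
  rfl

/-- The Gram map into the dual of a finite-dimensional space is injective by definiteness, hence
surjective; the projection represents the functional q ↦ (f, q). -/
theorem exists_isPolyProj {a b : ℝ} (ha : -1 < a) (hb : -1 < b) (N : ℕ) {f : ℝ → ℝ}
    (hf : MemL2 a b f) : ∃ p, IsPolyProj a b N f p := by
  let V := Polynomial.degreeLT ℝ (N + 1)
  have : FiniteDimensional ℝ V :=
    Module.Finite.equiv (Polynomial.degreeLTEquiv ℝ (N + 1)).symm
  let Φ : V →ₗ[ℝ] Module.Dual ℝ V := LinearMap.mk₂ ℝ
    (fun p q => innerW a b (fun x => p.1.eval x) (fun x => q.1.eval x))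
    (fun p p' q => by
      simpa using innerW_add_left (memL2_eval ha hb _) (memL2_eval ha hb _) (memL2_eval ha hb _))
    (fun c p q => by simpa using innerW_const_mul_left c _ _)
    (fun p q q' => by
      simpa using innerW_add_right (memL2_eval ha hb _) (memL2_eval ha hb _) (memL2_eval ha hb _))
    (fun c p q => by simpa using innerW_const_mul_right c _ _)
  let F : Module.Dual ℝ V :=
    { toFun := fun q => innerW a b f (fun x => q.1.eval x)
      map_add' := fun q q' => by
        simpa using innerW_add_right (memL2_eval ha hb _) (memL2_eval ha hb _) hf
      map_smul' := fun c q => by simpa using innerW_const_mul_right c f _ }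
  have hinj : Function.Injective Φ := by
    rw [injective_iff_map_eq_zero]
    intro p hp
    exact Subtype.ext (innerW_eval_self_eq_zero ha hb (LinearMap.congr_fun hp p))
  obtain ⟨p, hp⟩ := (LinearMap.injective_iff_surjective_of_finrank_eq_finrank
    Subspace.dual_finrank_eq.symm).1 hinj F
  refine ⟨p.1, mem_degreeLT_succ_iff.1 p.2, fun q hq => ?_⟩
  rw [innerW_sub_left (memL2_eval ha hb _) hf (memL2_eval ha hb _), sub_eq_zero]
  exact LinearMap.congr_fun hp ⟨q, mem_degreeLT_succ_iff.2 hq⟩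

theorem IsPolyProj.unique {a b : ℝ} (ha : -1 < a) (hb : -1 < b) {N : ℕ} {f : ℝ → ℝ}
    (hf : MemL2 a b f) {p q : Polynomial ℝ} (hp : IsPolyProj a b N f p)
    (hq : IsPolyProj a b N f q) : p = q := by
  have hd : (p - q).natDegree ≤ N := (Polynomial.natDegree_sub_le_of_le hp.1 hq.1).trans (by simp)
  have h1 := hp.2 _ hd
  have h2 := hq.2 _ hd
  rw [innerW_sub_left (memL2_eval ha hb _) hf (memL2_eval ha hb _)] at h1 h2
  refine sub_eq_zero.1 (innerW_eval_self_eq_zero ha hb ?_)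
  have : (fun x => (p - q).eval x) = fun x => p.eval x - q.eval x := by ext x; simp
  nth_rewrite 1 [this]
  rw [innerW_sub_left (memL2_eval ha hb _) (memL2_eval ha hb _) (memL2_eval ha hb _)]
  linarith

/-! ### Weak derivatives and integration by parts -/

/-- `h₁` is minus the weak derivative of `h` on `Λ`. -/
def IsWeakNegDeriv (h h₁ : ℝ → ℝ) : Prop :=
  ∀ φ : ℝ → ℝ, ContDiff ℝ (⊤ : ℕ∞) φ → HasCompactSupport φ → tsupport φ ⊆ Lam →
    ∫ x in Lam, h₁ x * φ x = ∫ x in Lam, h x * deriv φ x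

theorem integral_Lam_mul_deriv {f φ : ℝ → ℝ} (hf : ContDiff ℝ (⊤ : ℕ∞) f)
    (hφ : ContDiff ℝ (⊤ : ℕ∞) φ) (hc : HasCompactSupport φ) (hs : tsupport φ ⊆ Lam) :
    ∫ x in Lam, f x * deriv φ x = -∫ x in Lam, deriv f x * φ x := by
  have hφ' : Continuous (deriv φ) := hφ.continuous_deriv (by simp)
  have hf' : Continuous (deriv f) := hf.continuous_deriv (by simp)
  rw [setIntegral_eq_integral_of_forall_compl_eq_zero,
    setIntegral_eq_integral_of_forall_compl_eq_zero]
  · refine integral_mul_deriv_eq_deriv_mul_of_integrable (u := f) (v := φ)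
      (fun x _ => (hf.differentiable (by simp) x).hasDerivAt)
      (fun x _ => (hφ.differentiable (by simp) x).hasDerivAt) ?_ ?_ ?_
    · exact (hf.continuous.mul hφ').integrable_of_hasCompactSupport hc.deriv.mul_left
    · exact (hf'.mul hφ.continuous).integrable_of_hasCompactSupport hc.mul_left
    · exact (hf.continuous.mul hφ.continuous).integrable_of_hasCompactSupport hc.mul_left
  · intro x hx
    rw [image_eq_zero_of_notMem_tsupport fun h => hx (hs h), mul_zero]
  · intro x hx
    rw [image_eq_zero_of_notMem_tsupport fun h => hx (hs (tsupport_deriv_subset h)),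
      mul_zero]

theorem contDiff_eval (p : Polynomial ℝ) : ContDiff ℝ (⊤ : ℕ∞) fun x => p.eval x := by
  simpa using Polynomial.contDiff_aeval (𝕜 := ℝ) p (⊤ : ℕ∞)

theorem isWeakNegDeriv_eval (p : Polynomial ℝ) :
    IsWeakNegDeriv (fun x => p.eval x) (fun x => (-p.derivative).eval x) := by
  intro φ hφ hc hs
  rw [integral_Lam_mul_deriv (f := fun x => p.eval x) (contDiff_eval p) hφ hc hs, ← integral_neg]
  congr 1; ext x
  simp

/-- A smooth function on the line that equals `1` where `n (1 - x²) ≥ 2` and vanishes where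
`n (1 - x²) ≤ 1`. -/
def cutoff (n : ℕ) (x : ℝ) : ℝ := Real.smoothTransition (n * (1 - x ^ 2) - 1)

theorem contDiff_cutoff (n : ℕ) : ContDiff ℝ (⊤ : ℕ∞) (cutoff n) :=
  Real.smoothTransition.contDiff.comp (by fun_prop)

theorem hasDerivAt_cutoff (n : ℕ) (x : ℝ) :
    HasDerivAt (cutoff n)
      (deriv Real.smoothTransition (n * (1 - x ^ 2) - 1) * (n * -(2 * x))) x := by
  have h1 : HasDerivAt Real.smoothTransition
      (deriv Real.smoothTransition (n * (1 - x ^ 2) - 1)) (n * (1 - x ^ 2) - 1) :=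
    ((Real.smoothTransition.contDiff (n := 1)).differentiable (by simp) _).hasDerivAt
  refine h1.comp x ?_
  have h2 := (((hasDerivAt_pow 2 x).const_sub 1).const_mul (n : ℝ)).sub_const 1
  simpa using h2

theorem deriv_smoothTransition_of_one_lt {x : ℝ} (hx : 1 < x) :
    deriv Real.smoothTransition x = 0 := by
  have : Real.smoothTransition =ᶠ[𝓝 x] fun _ => 1 := by
    filter_upwards [lt_mem_nhds hx] with y hy
    exact Real.smoothTransition.one_of_one_le hy.le
  rw [this.deriv_eq, deriv_const]

/-- The derivative of the cutoff is of size O(n), but it vanishes where n(1 - x²) > 2; the factor 1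
- x² therefore compensates n uniformly. -/
theorem exists_bound_deriv_cutoff :
    ∃ C : ℝ, ∀ (n : ℕ) (x : ℝ), x ∈ Lam → |(1 - x ^ 2) * deriv (cutoff n) x| ≤ C := by
  obtain ⟨C, hC⟩ := isCompact_Icc.exists_bound_of_continuousOn (s := Icc (-1 : ℝ) 1)
    ((Real.smoothTransition.contDiff (n := 1)).continuous_deriv (by simp)).continuousOn
  have hC0 : 0 ≤ C := (norm_nonneg _).trans (hC 0 (by simp))
  refine ⟨4 * C, fun n x hx => ?_⟩
  have hx2 : 0 < 1 - x ^ 2 := by nlinarith [hx.1, hx.2]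
  have hxa : |x| ≤ 1 := abs_le.2 ⟨hx.1.le, hx.2.le⟩
  rw [(hasDerivAt_cutoff n x).deriv]
  have hn : 0 ≤ n * (1 - x ^ 2) := by positivity
  rcases lt_or_ge 1 (n * (1 - x ^ 2) - 1) with h | h
  · rw [deriv_smoothTransition_of_one_lt h]
    simpa using hC0
  · have h1 := hC _ ⟨by linarith, h⟩
    rw [Real.norm_eq_abs] at h1
    calc |(1 - x ^ 2) * (deriv Real.smoothTransition (n * (1 - x ^ 2) - 1) * (n * -(2 * x)))|
        = |deriv Real.smoothTransition (n * (1 - x ^ 2) - 1)| * (2 * (n * (1 - x ^ 2)) * |x|) := by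
          rw [abs_mul, abs_mul, abs_mul, abs_neg, abs_mul, abs_of_pos hx2,
            Nat.abs_cast, abs_of_pos (two_pos : (0 : ℝ) < 2)]
          ring
      _ ≤ C * (2 * 2 * 1) := by
          gcongr
          linarith
      _ = 4 * C := by ring

theorem eventually_cutoff {x : ℝ} (hx : x ∈ Lam) :
    ∀ᶠ n : ℕ in atTop, cutoff n x = 1 ∧ deriv (cutoff n) x = 0 := by
  have hx2 : 0 < 1 - x ^ 2 := by nlinarith [hx.1, hx.2]
  have ht : Tendsto (fun n : ℕ => (n : ℝ) * (1 - x ^ 2) - 1) atTop atTop :=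
    tendsto_atTop_add_const_right _ _
      (tendsto_natCast_atTop_atTop.atTop_mul_const hx2)
  filter_upwards [ht.eventually_gt_atTop 1] with n hn
  refine ⟨Real.smoothTransition.one_of_one_le hn.le, ?_⟩
  rw [(hasDerivAt_cutoff n x).deriv, deriv_smoothTransition_of_one_lt hn, zero_mul]

theorem cutoff_mem_Icc (n : ℕ) (x : ℝ) : cutoff n x ∈ Icc 0 1 :=
  ⟨Real.smoothTransition.nonneg _, Real.smoothTransition.le_one _⟩

theorem tsupport_cutoff_subset (n : ℕ) : tsupport (cutoff n) ⊆ Lam := by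
  have h1 : tsupport (cutoff n) ⊆ {x : ℝ | 1 ≤ n * (1 - x ^ 2)} := by
    refine closure_minimal (fun x hx => ?_) (isClosed_le (by fun_prop) (by fun_prop))
    by_contra hc
    exact hx (Real.smoothTransition.zero_of_nonpos (by simp at hc; linarith))
  intro x hx
  have h2 : 1 ≤ n * (1 - x ^ 2) := h1 hx
  have h3 : 0 < 1 - x ^ 2 := by
    by_contra hc
    nlinarith [mul_nonneg (Nat.cast_nonneg (α := ℝ) n) (neg_nonneg.2 (not_lt.1 hc))]
  exact abs_lt.1 ((sq_lt_one_iff_abs_lt_one x).1 (by linarith))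

theorem hasCompactSupport_of_tsupport_subset {φ : ℝ → ℝ} (h : tsupport φ ⊆ Lam) :
    HasCompactSupport φ :=
  isCompact_Icc.of_isClosed_subset (isClosed_tsupport φ) (h.trans Ioo_subset_Icc_self)

theorem integrableOn_mul_of_tsupport_subset {f ψ : ℝ → ℝ} (hf : LocallyIntegrableOn f Lam)
    (hψ : Continuous ψ) (hs : tsupport ψ ⊆ Lam) : IntegrableOn (fun x => f x * ψ x) Lam := by
  have hK := hasCompactSupport_of_tsupport_subset hs
  have h1 := (hf.integrableOn_compact_subset hs hK).mul_continuousOn hψ.continuousOn hK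
  rw [integrableOn_iff_integrable_of_support_subset] at h1
  · exact h1.integrableOn
  · intro x hx
    by_contra hc
    exact hx (by simp [image_eq_zero_of_notMem_tsupport hc])

theorem contDiff_cutoff_mul (n : ℕ) {ψ : ℝ → ℝ} (hψ : ∀ x ∈ Lam, ContDiffAt ℝ (⊤ : ℕ∞) ψ x) :
    ContDiff ℝ (⊤ : ℕ∞) fun x => cutoff n x * ψ x := by
  refine contDiff_iff_contDiffAt.2 fun x => ?_
  by_cases hx : x ∈ tsupport (cutoff n)
  · exact (contDiff_cutoff n).contDiffAt.mul (hψ x (tsupport_cutoff_subset n hx))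
  · refine (contDiffAt_const (c := (0 : ℝ))).congr_of_eventuallyEq ?_
    filter_upwards [notMem_tsupport_iff_eventuallyEq.1 hx] with y hy
    simp [hy]

theorem tsupport_cutoff_mul_subset (n : ℕ) (ψ : ℝ → ℝ) :
    tsupport (fun x => cutoff n x * ψ x) ⊆ Lam :=
  (tsupport_mul_subset_left (f := cutoff n) (g := ψ)).trans (tsupport_cutoff_subset n)

theorem contDiffAt_weight (a b : ℝ) {x : ℝ} (hx : x ∈ Lam) :
    ContDiffAt ℝ (⊤ : ℕ∞) (weight a b) x := by
  have h1 : 1 - x ≠ 0 := by linarith [hx.2]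
  have h2 : 1 + x ≠ 0 := by linarith [hx.1]
  unfold weight
  exact (ContDiffAt.rpow_const_of_ne (by fun_prop) h1).mul
    (ContDiffAt.rpow_const_of_ne (by fun_prop) h2)

/-- The operator `r ↦ (1 - x²) r' + ((b + 1) (1 - x) - (a + 1) (1 + x)) r`, formally adjoint to
minus the derivative with respect to the Jacobi weights. -/
def jacobiAdj (a b : ℝ) (r : Polynomial ℝ) : Polynomial ℝ :=
  (1 - Polynomial.X ^ 2) * r.derivative +
    (Polynomial.C (b - a) - Polynomial.C (a + b + 2) * Polynomial.X) * r

theorem hasDerivAt_weight_add_one (a b : ℝ) {x : ℝ} (hx : x ∈ Lam) :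
    HasDerivAt (weight (a + 1) (b + 1))
      ((b - a - (a + b + 2) * x) * weight a b x) x := by
  have h1 : 1 - x ≠ 0 := by linarith [hx.2]
  have h2 : 1 + x ≠ 0 := by linarith [hx.1]
  have d1 := ((hasDerivAt_id x).const_sub 1).rpow_const (p := a + 1) (Or.inl h1)
  have d2 := ((hasDerivAt_id x).const_add 1).rpow_const (p := b + 1) (Or.inl h2)
  refine (d1.mul d2).congr_deriv ?_
  simp only [id, weight, add_sub_cancel_right]
  rw [Real.rpow_add_one h1, Real.rpow_add_one h2]
  ring

theorem hasDerivAt_eval_mul_weight (a b : ℝ) (r : Polynomial ℝ) {x : ℝ} (hx : x ∈ Lam) :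
    HasDerivAt (fun y => r.eval y * weight (a + 1) (b + 1) y)
      ((jacobiAdj a b r).eval x * weight a b x) x := by
  refine ((r.hasDerivAt x).mul (hasDerivAt_weight_add_one a b hx)).congr_deriv ?_
  rw [weight_add_one hx]
  simp [jacobiAdj]
  ring

/-- Test the weak derivative with cutoff · r · ω^{(a+1,b+1)}. The term where the cutoff is
differentiated carries ω^{(a+1,b+1)} = (1 - x²) ω^{(a,b)}, so it is dominated uniformly in n and
tends to 0 pointwise. Dominated convergence removes the cutoff and leaves no boundary term. -/
theorem IsWeakNegDeriv.innerW_eq {a b : ℝ} (ha : -1 < a) (hb : -1 < b) {h h₁ : ℝ → ℝ}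
    (hh : MemL2 a b h) (hh₁ : MemL2 (a + 1) (b + 1) h₁) (hw : IsWeakNegDeriv h h₁)
    (r : Polynomial ℝ) :
    innerW (a + 1) (b + 1) h₁ (fun x => r.eval x) =
      innerW a b h (fun x => (jacobiAdj a b r).eval x) := by
  have hr := memL2_eval (a := a + 1) (b := b + 1) (by linarith) (by linarith) r
  have hr0 := memL2_eval (a := a) (b := b) ha hb r
  have hA := memL2_eval (a := a) (b := b) ha hb (jacobiAdj a b r)
  obtain ⟨C, hC⟩ := exists_bound_deriv_cutoff
  have key : ∀ n : ℕ,
      ∫ x in Lam, h₁ x * r.eval x * weight (a + 1) (b + 1) x * cutoff n x =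
      ∫ x in Lam, h x * r.eval x * weight a b x * ((1 - x ^ 2) * deriv (cutoff n) x) +
        h x * (jacobiAdj a b r).eval x * weight a b x * cutoff n x := by
    intro n
    have hs := tsupport_cutoff_mul_subset n fun y => r.eval y * weight (a + 1) (b + 1) y
    have := hw _ (contDiff_cutoff_mul n fun x hx =>
      (contDiff_eval r).contDiffAt.mul (contDiffAt_weight (a + 1) (b + 1) hx))
      (hasCompactSupport_of_tsupport_subset hs) hs
    convert this using 1
    · congr 1; ext x; ring
    · refine setIntegral_congr_fun measurableSet_Lam fun x hx => ?_
      have hd := ((contDiff_cutoff n).differentiable (by simp) x).hasDerivAt.mul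
        (hasDerivAt_eval_mul_weight a b r hx)
      have hd' : deriv (fun x => cutoff n x * (r.eval x * weight (a + 1) (b + 1) x)) x = _ :=
        hd.deriv
      rw [hd', weight_add_one hx]
      ring
  have lim1 : Tendsto
      (fun n : ℕ => ∫ x in Lam, h₁ x * r.eval x * weight (a + 1) (b + 1) x * cutoff n x) atTop
      (𝓝 (innerW (a + 1) (b + 1) h₁ fun x => r.eval x)) := by
    have hi := hh₁.integrableOn_mul hr
    refine tendsto_integral_of_dominated_convergence
      (fun x => ‖h₁ x * r.eval x * weight (a + 1) (b + 1) x‖) (fun n => ?_) hi.norm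
      (fun n => ae_of_all _ fun x => ?_) ?_
    · exact hi.aestronglyMeasurable.mul (contDiff_cutoff n).continuous.aestronglyMeasurable
    · rw [norm_mul]
      refine mul_le_of_le_one_right (norm_nonneg _) ?_
      rw [Real.norm_of_nonneg (cutoff_mem_Icc n x).1]
      exact (cutoff_mem_Icc n x).2
    · filter_upwards [ae_restrict_mem measurableSet_Lam] with x hx
      refine tendsto_const_nhds.congr' ?_
      filter_upwards [eventually_cutoff hx] with n hn
      rw [hn.1, mul_one]
  have lim2 : Tendsto
      (fun n : ℕ => ∫ x in Lam,
        h x * r.eval x * weight a b x * ((1 - x ^ 2) * deriv (cutoff n) x) +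
        h x * (jacobiAdj a b r).eval x * weight a b x * cutoff n x) atTop
      (𝓝 (innerW a b h fun x => (jacobiAdj a b r).eval x)) := by
    have hi := hh.integrableOn_mul hr0
    have hi' := hh.integrableOn_mul hA
    refine tendsto_integral_of_dominated_convergence
      (fun x => ‖h x * r.eval x * weight a b x‖ * C +
        ‖h x * (jacobiAdj a b r).eval x * weight a b x‖) (fun n => ?_)
      ((hi.norm.mul_const C).add hi'.norm) (fun n => ?_) ?_
    · have c1 := (contDiff_cutoff n).continuous
      have c2 : Continuous (deriv (cutoff n)) := (contDiff_cutoff n).continuous_deriv (by simp)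
      exact (hi.aestronglyMeasurable.mul
          (Continuous.aestronglyMeasurable (by fun_prop))).add
        (hi'.aestronglyMeasurable.mul c1.aestronglyMeasurable)
    · filter_upwards [ae_restrict_mem measurableSet_Lam] with x hx
      refine (norm_add_le _ _).trans (add_le_add ?_ ?_)
      · rw [norm_mul]
        exact mul_le_mul_of_nonneg_left (hC n x hx) (norm_nonneg _)
      · rw [norm_mul]
        refine mul_le_of_le_one_right (norm_nonneg _) ?_
        rw [Real.norm_of_nonneg (cutoff_mem_Icc n x).1]
        exact (cutoff_mem_Icc n x).2
    · filter_upwards [ae_restrict_mem measurableSet_Lam] with x hx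
      refine tendsto_const_nhds.congr' ?_
      filter_upwards [eventually_cutoff hx] with n hn
      rw [hn.1, hn.2]
      ring
  exact tendsto_nhds_unique lim1 (lim2.congr fun n => (key n).symm)

/-! ### The weighted Poincaré inequality -/

theorem innerW_derivative_eq {a b : ℝ} (ha : -1 < a) (hb : -1 < b) (p r : Polynomial ℝ) :
    innerW (a + 1) (b + 1) (fun x => p.derivative.eval x) (fun x => r.eval x) =
      -innerW a b (fun x => p.eval x) (fun x => (jacobiAdj a b r).eval x) := by
  have h := (isWeakNegDeriv_eval p).innerW_eq ha hb (memL2_eval ha hb p)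
    (memL2_eval (by linarith) (by linarith) _) r
  rw [← h]
  have := innerW_const_mul_left (a := a + 1) (b := b + 1) (-1) (fun x => p.derivative.eval x)
    (fun x => r.eval x)
  simp only [Polynomial.eval_neg]
  simp only [neg_one_mul] at this
  rw [this, neg_neg]

theorem natDegree_jacobiAdj_le (a b : ℝ) {r : Polynomial ℝ} {n : ℕ} (hr : r.natDegree ≤ n) :
    (jacobiAdj a b r).natDegree ≤ n + 1 := by
  rw [Polynomial.natDegree_le_iff_coeff_eq_zero] at hr ⊢
  intro k hk
  obtain ⟨j, rfl⟩ : ∃ j, k = j + 2 := ⟨k - 2, by omega⟩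
  have e : jacobiAdj a b r = r.derivative - r.derivative * Polynomial.X ^ 2 +
      Polynomial.C (b - a) * r - Polynomial.C (a + b + 2) * (r * Polynomial.X) := by
    unfold jacobiAdj; ring
  rw [e]
  simp only [Polynomial.coeff_add, Polynomial.coeff_sub, Polynomial.coeff_C_mul,
    Polynomial.coeff_mul_X_pow, Polynomial.coeff_derivative]
  rw [show j + 2 = (j + 1) + 1 from rfl, Polynomial.coeff_mul_X, hr (j + 1 + 1) (by omega),
    hr (j + 1 + 1 + 1) (by omega), hr (j + 1) (by omega)]
  simp

/-- The Jacobi eigenvalue `λ_n = n (n + a + b + 1)`. -/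
def jacobiEig (a b : ℝ) (n : ℕ) : ℝ := n * (n + a + b + 1)

theorem jacobiEig_nonneg {a b : ℝ} (ha : -1 < a) (hb : -1 < b) (n : ℕ) :
    0 ≤ jacobiEig a b n := by
  unfold jacobiEig
  rcases Nat.eq_zero_or_pos n with rfl | hn
  · simp
  · have : (1 : ℝ) ≤ n := by exact_mod_cast hn
    exact mul_nonneg (by linarith) (by linarith)

theorem jacobiEig_mono {a b : ℝ} (ha : -1 < a) (hb : -1 < b) {n k : ℕ} (h : n ≤ k) :
    jacobiEig a b n ≤ jacobiEig a b k := by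
  rcases Nat.eq_zero_or_pos n with rfl | hn
  · simpa [jacobiEig] using jacobiEig_nonneg ha hb k
  · have h1 : (1 : ℝ) ≤ n := by exact_mod_cast hn
    have h2 : (n : ℝ) ≤ k := by exact_mod_cast h
    unfold jacobiEig
    exact mul_le_mul h2 (by linarith) (by linarith) (by linarith)

/-- The Jacobi operator multiplies the coefficient of X^(n+1) by minus the eigenvalue, so the top
terms cancel. -/
theorem natDegree_jacobiAdj_derivative_add (a b : ℝ) {q : Polynomial ℝ} {n : ℕ}
    (hq : q.natDegree ≤ n + 1) :
    (jacobiAdj a b q.derivative + Polynomial.C (jacobiEig a b (n + 1)) * q).natDegree ≤ n := by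
  have h1 : (jacobiAdj a b q.derivative).natDegree ≤ n + 1 :=
    natDegree_jacobiAdj_le a b ((Polynomial.natDegree_derivative_le q).trans (by omega))
  rw [Polynomial.natDegree_le_iff_coeff_eq_zero] at hq h1 ⊢
  intro k hk
  rw [Polynomial.coeff_add, Polynomial.coeff_C_mul]
  rcases Nat.lt_or_ge (n + 1) k with hk' | hk'
  · rw [h1 k hk', hq k hk']; simp
  · obtain rfl : k = n + 1 := by omega
    set s := q.derivative with hs
    have e : jacobiAdj a b s = s.derivative - s.derivative * Polynomial.X ^ 2 +
        Polynomial.C (b - a) * s - Polynomial.C (a + b + 2) * (s * Polynomial.X) := by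
      unfold jacobiAdj; ring
    have hc : (s.derivative * Polynomial.X ^ 2).coeff (n + 1) = q.coeff (n + 1) * (n + 1) * n := by
      rw [Polynomial.coeff_mul_X_pow']
      rcases n with _ | n
      · simp
      · simp [hs, Polynomial.coeff_derivative]
    rw [e]
    simp only [Polynomial.coeff_add, Polynomial.coeff_sub, Polynomial.coeff_C_mul, hc,
      Polynomial.coeff_mul_X]
    simp only [hs, Polynomial.coeff_derivative]
    rw [hq (n + 1 + 1) (by omega), hq (n + 1 + 1 + 1) (by omega)]
    unfold jacobiEig
    push_cast
    ring

/-- Induction on the degree bound, without constructing Jacobi polynomials: split p = r + Q with Q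
orthogonal to degree at most M. Up to lower degree, Q is an eigenvector, so its energy is exactly
λ_{M+1}‖Q‖²; the cross terms vanish both for the polynomials and for their derivatives, and λ is
monotone. -/
theorem jacobiEig_mul_innerW_le_of_natDegree_le {a b : ℝ} (ha : -1 < a) (hb : -1 < b) (N M : ℕ) :
    ∀ p : Polynomial ℝ, p.natDegree ≤ M →
      (∀ q : Polynomial ℝ, q.natDegree ≤ N →
        innerW a b (fun x => p.eval x) (fun x => q.eval x) = 0) →
      jacobiEig a b (N + 1) * innerW a b (fun x => p.eval x) (fun x => p.eval x) ≤
        innerW (a + 1) (b + 1) (fun x => p.derivative.eval x)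
          (fun x => p.derivative.eval x) := by
  have small : ∀ p : Polynomial ℝ, p.natDegree ≤ N →
      (∀ q : Polynomial ℝ, q.natDegree ≤ N →
        innerW a b (fun x => p.eval x) (fun x => q.eval x) = 0) →
      jacobiEig a b (N + 1) * innerW a b (fun x => p.eval x) (fun x => p.eval x) ≤
        innerW (a + 1) (b + 1) (fun x => p.derivative.eval x)
          (fun x => p.derivative.eval x) := by
    intro p hp h
    rw [h p hp, mul_zero]
    exact innerW_self_nonneg _
  induction M with
  | zero => exact fun p hp => small p (by omega)
  | succ M ih =>
    intro p hp h
    rcases Nat.lt_or_ge M N with hMN | hMN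
    · exact small p (by omega) h
    have ml := fun p => memL2_eval ha hb p
    have ml' := fun p => memL2_eval (a := a + 1) (b := b + 1) (by linarith) (by linarith) p
    obtain ⟨r, hr, hpr⟩ := exists_isPolyProj ha hb M (ml p)
    obtain ⟨Q, rfl⟩ : ∃ Q, p = r + Q := ⟨p - r, by ring⟩
    have hQ : Q.natDegree ≤ M + 1 := by
      have := Polynomial.natDegree_sub_le_of_le hp (hr.trans (Nat.le_succ M))
      simpa using this
    have hQo : ∀ q : Polynomial ℝ, q.natDegree ≤ M →
        innerW a b (fun x => Q.eval x) (fun x => q.eval x) = 0 := by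
      intro q hq
      have h1 := hpr q hq
      have h2 : (fun x => r.eval x - (r + Q).eval x) = fun x => (-1) * Q.eval x := by
        ext x; simp
      rw [h2, innerW_const_mul_left] at h1
      linarith
    have hro : ∀ q : Polynomial ℝ, q.natDegree ≤ N →
        innerW a b (fun x => r.eval x) (fun x => q.eval x) = 0 := by
      intro q hq
      have h1 := h q hq
      simp only [Polynomial.eval_add] at h1
      rw [innerW_add_left (ml r) (ml Q) (ml q), hQo q (hq.trans hMN), add_zero] at h1
      exact h1
    have ihr := ih r hr hro
    have hd : (jacobiAdj a b r.derivative).natDegree ≤ M := by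
      -- For M = 0 the general degree bound only gives 1, but then r is constant and its derivative
      -- vanishes.
      rcases M with _ | M
      · have : r.derivative = 0 := by
          rw [Polynomial.eq_C_of_natDegree_le_zero hr, Polynomial.derivative_C]
        simp [this, jacobiAdj]
      · exact natDegree_jacobiAdj_le a b ((Polynomial.natDegree_derivative_le r).trans (by omega))
    have hcross : innerW (a + 1) (b + 1) (fun x => Q.derivative.eval x)
        (fun x => r.derivative.eval x) = 0 := by
      rw [innerW_derivative_eq ha hb, hQo _ hd, neg_zero]
    have hQQ : innerW (a + 1) (b + 1) (fun x => Q.derivative.eval x)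
        (fun x => Q.derivative.eval x) =
        jacobiEig a b (M + 1) * innerW a b (fun x => Q.eval x) (fun x => Q.eval x) := by
      have h1 := hQo _ (natDegree_jacobiAdj_derivative_add a b hQ)
      simp only [Polynomial.eval_add, Polynomial.eval_mul, Polynomial.eval_C] at h1
      have m2 : MemL2 a b fun x => jacobiEig a b (M + 1) * Q.eval x := by
        simpa using ml (Polynomial.C (jacobiEig a b (M + 1)) * Q)
      rw [innerW_add_right (ml _) m2 (ml Q), innerW_const_mul_right] at h1
      rw [innerW_derivative_eq ha hb]
      linarith
    have hmono := mul_le_mul_of_nonneg_right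
      (jacobiEig_mono ha hb (show N + 1 ≤ M + 1 by omega))
      (innerW_self_nonneg (a := a) (b := b) fun x => Q.eval x)
    have e1 : innerW a b (fun x => (r + Q).eval x) (fun x => (r + Q).eval x) =
        innerW a b (fun x => r.eval x) (fun x => r.eval x) +
          innerW a b (fun x => Q.eval x) (fun x => Q.eval x) := by
      simp only [Polynomial.eval_add]
      rw [innerW_add_left (ml r) (ml Q) ((ml r).add (ml Q)),
        innerW_add_right (ml r) (ml Q) (ml r), innerW_add_right (ml r) (ml Q) (ml Q),
        innerW_comm (fun x => r.eval x) (fun x => Q.eval x), hQo r hr]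
      ring
    have e2 : innerW (a + 1) (b + 1) (fun x => (r + Q).derivative.eval x)
        (fun x => (r + Q).derivative.eval x) =
        innerW (a + 1) (b + 1) (fun x => r.derivative.eval x) (fun x => r.derivative.eval x) +
          innerW (a + 1) (b + 1) (fun x => Q.derivative.eval x)
            (fun x => Q.derivative.eval x) := by
      simp only [Polynomial.derivative_add, Polynomial.eval_add]
      rw [innerW_add_left (ml' _) (ml' _) ((ml' _).add (ml' _)),
        innerW_add_right (ml' _) (ml' _) (ml' _), innerW_add_right (ml' _) (ml' _) (ml' _),
        innerW_comm (fun x => r.derivative.eval x) (fun x => Q.derivative.eval x), hcross]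
      ring
    rw [e1, e2, hQQ]
    linarith

theorem IsPolyProj.innerW_eval_eq {a b : ℝ} (ha : -1 < a) (hb : -1 < b) {N : ℕ} {f : ℝ → ℝ}
    (hf : MemL2 a b f) {p : Polynomial ℝ} (hp : IsPolyProj a b N f p) {q : Polynomial ℝ}
    (hq : q.natDegree ≤ N) :
    innerW a b f (fun x => q.eval x) = innerW a b (fun x => p.eval x) (fun x => q.eval x) := by
  have h := hp.2 q hq
  rw [innerW_sub_left (memL2_eval ha hb p) hf (memL2_eval ha hb q)] at h
  linarith

/-- The weighted Poincaré inequality for functions orthogonal to low-degree polynomials. -/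
theorem IsWeakNegDeriv.jacobiEig_mul_innerW_le {a b : ℝ} (ha : -1 < a) (hb : -1 < b)
    {h h₁ : ℝ → ℝ} (hh : MemL2 a b h) (hh₁ : MemL2 (a + 1) (b + 1) h₁)
    (hw : IsWeakNegDeriv h h₁) {N : ℕ}
    (ho : ∀ q : Polynomial ℝ, q.natDegree ≤ N → innerW a b h (fun x => q.eval x) = 0) :
    jacobiEig a b (N + 1) * innerW a b h h ≤ innerW (a + 1) (b + 1) h₁ h₁ := by
  have ml := fun p => memL2_eval ha hb p
  have ml' := fun p => memL2_eval (a := a + 1) (b := b + 1) (by linarith) (by linarith) p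
  have hlam := jacobiEig_nonneg ha hb (N + 1)
  set L := jacobiEig a b (N + 1) with hL
  have main : ∀ ε : ℝ, 0 < ε → L * (innerW a b h h - ε) ≤ innerW (a + 1) (b + 1) h₁ h₁ := by
    intro ε hε
    obtain ⟨q, hq⟩ := exists_polynomial_innerW_sub_le ha hb hh hε
    -- M ≥ N lets p inherit the orthogonality of h, M ≥ deg q makes p at least as good an
    -- approximation as q, and M ≥ 1 keeps `jacobiAdj a b p.derivative` within degree M.
    set M := max N (q.natDegree + 1) with hM
    obtain ⟨p, hp⟩ := exists_isPolyProj ha hb M hh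
    have hpo : ∀ s : Polynomial ℝ, s.natDegree ≤ N →
        innerW a b (fun x => p.eval x) (fun x => s.eval x) = 0 := by
      intro s hs
      rw [← hp.innerW_eval_eq ha hb hh (hs.trans (le_max_left _ _)), ho s hs]
    have h1 := jacobiEig_mul_innerW_le_of_natDegree_le ha hb N M p hp.1 hpo
    have hdeg : (jacobiAdj a b p.derivative).natDegree ≤ M := by
      have hM1 : 1 ≤ M := le_trans (by omega) (le_max_right N (q.natDegree + 1))
      have := Polynomial.natDegree_derivative_le p
      exact (natDegree_jacobiAdj_le a b (n := M - 1) (by have := hp.1; omega)).trans (by omega)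
    -- This relation turns ‖h₁ + p'‖² ≥ 0 into the Bessel-type bound ‖p'‖² ≤ ‖h₁‖².
    have h2 : innerW (a + 1) (b + 1) h₁ (fun x => p.derivative.eval x) =
        -innerW (a + 1) (b + 1) (fun x => p.derivative.eval x)
          (fun x => p.derivative.eval x) := by
      rw [hw.innerW_eq ha hb hh hh₁, hp.innerW_eval_eq ha hb hh hdeg, innerW_derivative_eq ha hb,
        neg_neg]
    have h3 := innerW_self_nonneg (a := a + 1) (b := b + 1)
      fun x => h₁ x + p.derivative.eval x
    rw [innerW_add_left hh₁ (ml' _) (hh₁.add (ml' _)), innerW_add_right hh₁ (ml' _) hh₁,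
      innerW_add_right hh₁ (ml' _) (ml' _), innerW_comm (fun x => p.derivative.eval x) h₁,
      h2] at h3
    have h4 : innerW a b h h - ε ≤ innerW a b (fun x => p.eval x) (fun x => p.eval x) := by
      have e1 := hp.innerW_eval_eq ha hb hh
        (show q.natDegree ≤ M from le_trans (by omega) (le_max_right _ _))
      have h5 := innerW_self_nonneg (a := a) (b := b) fun x => p.eval x - q.eval x
      rw [innerW_sub_left (ml _) (ml _) ((ml _).sub (ml _)), innerW_sub_right (ml _) (ml _) (ml _),
        innerW_sub_right (ml _) (ml _) (ml _),
        innerW_comm (fun x => q.eval x) (fun x => p.eval x)] at h5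
      rw [innerW_sub_left hh (ml _) (hh.sub (ml _)), innerW_sub_right hh (ml _) hh,
        innerW_sub_right hh (ml _) (ml _), innerW_comm (fun x => q.eval x) h, e1] at hq
      linarith
    have h5 := mul_le_mul_of_nonneg_left h4 hlam
    linarith
  refine le_of_forall_pos_le_add fun δ hδ => ?_
  -- L + 1 is a positive denominator when only L ≥ 0 is at hand.
  have h1 := main (δ / (L + 1)) (by positivity)
  have h2 : L * (δ / (L + 1)) ≤ δ := by
    rw [mul_div_assoc', div_le_iff₀ (by positivity)]
    nlinarith
  rw [mul_sub] at h1
  linarith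

/-- Passing to the derivative commutes with the weighted projections, and decreases the
projection error by the corresponding Jacobi eigenvalue. -/
theorem IsPolyProj.derivative {a b : ℝ} (ha : -1 < a) (hb : -1 < b) {g g₁ : ℝ → ℝ}
    (hg : MemL2 a b g) (hg₁ : MemL2 (a + 1) (b + 1) g₁) (hw : IsWeakNegDeriv g g₁)
    (hloc : LocallyIntegrableOn g Lam) (hloc₁ : LocallyIntegrableOn g₁ Lam)
    {N : ℕ} {p : Polynomial ℝ} (hp : IsPolyProj a b (N + 1) g p) :
    IsPolyProj (a + 1) (b + 1) N g₁ (-p.derivative) ∧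
      jacobiEig a b (N + 2) *
          innerW a b (fun x => p.eval x - g x) (fun x => p.eval x - g x) ≤
        innerW (a + 1) (b + 1) (fun x => (-p.derivative).eval x - g₁ x)
          (fun x => (-p.derivative).eval x - g₁ x) := by
  have ml := fun p => memL2_eval ha hb p
  have ml' := fun p => memL2_eval (a := a + 1) (b := b + 1) (by linarith) (by linarith) p
  have hh := (ml p).sub hg
  have hh₁ := (ml' (-p.derivative)).sub hg₁
  have hint := @integrableOn_mul_of_tsupport_subset
  have hw' : IsWeakNegDeriv (fun x => p.eval x - g x)
      (fun x => (-p.derivative).eval x - g₁ x) := by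
    intro φ hφ hc hs
    have h1 := isWeakNegDeriv_eval p φ hφ hc hs
    have h2 := hw φ hφ hc hs
    have hφ' : Continuous (deriv φ) := hφ.continuous_deriv (by simp)
    have hs' : tsupport (deriv φ) ⊆ Lam := tsupport_deriv_subset.trans hs
    have lp : ∀ q : Polynomial ℝ, LocallyIntegrableOn (fun x => q.eval x) Lam := fun q =>
      q.continuous.locallyIntegrable.locallyIntegrableOn _
    simp only [sub_mul]
    rw [integral_sub (hint (lp _) hφ.continuous hs) (hint hloc₁ hφ.continuous hs),
      integral_sub (hint (lp _) hφ' hs') (hint hloc hφ' hs'), h2]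
    rw [h1]
  refine ⟨⟨?_, fun q hq => ?_⟩, hw'.jacobiEig_mul_innerW_le ha hb hh hh₁ hp.2⟩
  · rw [Polynomial.natDegree_neg]
    exact (Polynomial.natDegree_derivative_le p).trans (by have := hp.1; omega)
  -- A test polynomial of degree at most N becomes one of degree at most N + 1, to which the
  -- original error is orthogonal.
  · rw [hw'.innerW_eq ha hb hh hh₁]
    exact hp.2 _ (natDegree_jacobiAdj_le a b hq)

/-! ### Fractional integrals and derivatives -/

/-- Differences of points of Λ lie below 2, so the kernel may be cut to (0, 2), where it is
integrable. The integrand of a convolution of two integrable functions is integrable on the product;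
Fubini then gives a.e. existence and local integrability of the fractional integral. -/
theorem integrable_indicator_mul_kernel {v : ℝ → ℝ} {ρ c : ℝ} (hρ : 0 < ρ)
    (hv : IntegrableOn v (Ioo c 1)) :
    Integrable (fun z : ℝ × ℝ => (Ioo c 1).indicator v z.2 *
      (Ioo (0 : ℝ) 2).indicator (fun t => t ^ (ρ - 1)) (z.2 - z.1)) (volume.prod volume) := by
  have hV : Integrable ((Ioo c 1).indicator v) := hv.integrable_indicator measurableSet_Ioo
  have hk : IntegrableOn (fun t : ℝ => t ^ (ρ - 1)) (Ioo 0 2) := by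
    have := intervalIntegral.intervalIntegrable_rpow' (a := 0) (b := 2) (r := ρ - 1) (by linarith)
    rw [intervalIntegrable_iff_integrableOn_Ioo_of_le (by norm_num)] at this
    exact this
  have hK : Integrable ((Ioo (0 : ℝ) 2).indicator fun t => t ^ (ρ - 1)) :=
    hk.integrable_indicator measurableSet_Ioo
  have := hV.convolution_integrand (ContinuousLinearMap.mul ℝ ℝ) hK.comp_neg
  simpa using this

theorem indicator_mul_kernel {v : ℝ → ℝ} {ρ c x : ℝ} (hc : c ∈ Lam) (hx : x ∈ Ioo c 1) (y : ℝ) :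
    (Ioo c 1).indicator v y * (Ioo (0 : ℝ) 2).indicator (fun t => t ^ (ρ - 1)) (y - x) =
      (Ioo x 1).indicator (fun y => v y * (y - x) ^ (ρ - 1)) y := by
  have hc1 := hc.1
  have hx1 := hx.1
  have hx2 := hx.2
  by_cases hy : y ∈ Ioo x 1
  · have h1 : y ∈ Ioo c 1 := ⟨hx1.trans hy.1, hy.2⟩
    have h2 : y - x ∈ Ioo (0 : ℝ) 2 := ⟨by linarith [hy.1], by linarith [hy.2]⟩
    rw [indicator_of_mem hy, indicator_of_mem h1, indicator_of_mem h2]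
  · rw [indicator_of_notMem hy]
    by_cases h1 : y ∈ Ioo c 1
    · have h2 : y - x ∉ Ioo (0 : ℝ) 2 := fun h => hy ⟨by linarith [h.1], h1.2⟩
      rw [indicator_of_notMem h2, mul_zero]
    · rw [indicator_of_notMem h1, zero_mul]

theorem ae_integrableOn_kernel {v : ℝ → ℝ} {ρ : ℝ} (hρ : 0 < ρ)
    (hv : ∀ x ∈ Lam, IntegrableOn v (Ioo x 1)) :
    ∀ᵐ x ∂volume.restrict Lam, IntegrableOn (fun y => v y * (y - x) ^ (ρ - 1)) (Ioo x 1) := by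
  -- Only integrability of v on (c, 1) for c in Λ is available, so Λ is exhausted by smaller
  -- intervals.
  refine ae_restrict_of_ae_restrict_inter_Ioo fun c d hc hd _ => ?_
  have h := (integrable_indicator_mul_kernel hρ (hv c hc)).prod_right_ae
  rw [ae_restrict_iff' (measurableSet_Lam.inter measurableSet_Ioo)]
  filter_upwards [h] with x hx hxm
  have hx' : x ∈ Ioo c 1 := ⟨hxm.2.1, hxm.1.2⟩
  rw [← integrable_indicator_iff measurableSet_Ioo]
  refine hx.congr (ae_of_all _ fun y => ?_)
  exact indicator_mul_kernel hc hx' y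

theorem locallyIntegrableOn_rightInt {v : ℝ → ℝ} {ρ : ℝ} (hρ : 0 < ρ)
    (hv : ∀ x ∈ Lam, IntegrableOn v (Ioo x 1)) : LocallyIntegrableOn (rightInt ρ v) Lam := by
  intro x hx
  have hx1 := hx.1
  have hx2 := hx.2
  have hc : (x - 1) / 2 ∈ Lam := ⟨by linarith, by linarith⟩
  refine ⟨Ioo ((x - 1) / 2) 1,
    mem_nhdsWithin_of_mem_nhds (Ioo_mem_nhds (by linarith) hx2), ?_⟩
  have h := (integrable_indicator_mul_kernel hρ (hv _ hc)).integral_prod_left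
  refine ((h.const_mul (Real.Gamma ρ)⁻¹).integrableOn (s := Ioo ((x - 1) / 2) 1)).congr_fun
    (fun z hz => ?_) measurableSet_Ioo
  simp only [rightInt]
  rw [← integral_indicator measurableSet_Ioo]
  congr 2
  ext y
  exact indicator_mul_kernel hc hz y

theorem rightInt_add_ae {v v' : ℝ → ℝ} {ρ : ℝ} (hρ : 0 < ρ)
    (hv : ∀ x ∈ Lam, IntegrableOn v (Ioo x 1)) (hv' : ∀ x ∈ Lam, IntegrableOn v' (Ioo x 1)) :
    ∀ᵐ x ∂volume.restrict Lam,
      rightInt ρ (fun y => v y + v' y) x = rightInt ρ v x + rightInt ρ v' x := by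
  filter_upwards [ae_integrableOn_kernel hρ hv, ae_integrableOn_kernel hρ hv'] with x h h'
  simp only [rightInt, add_mul]
  rw [integral_add h h', mul_add]

theorem rightInt_const_mul (c ρ : ℝ) (v : ℝ → ℝ) (x : ℝ) :
    rightInt ρ (fun y => c * v y) x = c * rightInt ρ v x := by
  simp only [rightInt, mul_assoc, integral_const_mul]
  ring

theorem contDiff_iteratedDeriv {φ : ℝ → ℝ} (hφ : ContDiff ℝ (⊤ : ℕ∞) φ) (k : ℕ) :
    ContDiff ℝ (⊤ : ℕ∞) (iteratedDeriv k φ) := by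
  rw [iteratedDeriv_eq_iterate]
  exact hφ.iterate_deriv k

theorem tsupport_iteratedDeriv_subset {φ : ℝ → ℝ} (k : ℕ) :
    tsupport (iteratedDeriv k φ) ⊆ tsupport φ := by
  induction k with
  | zero => rw [iteratedDeriv_zero]
  | succ k ih =>
    rw [iteratedDeriv_succ]
    exact tsupport_deriv_subset.trans ih

/-! ### Linearity, uniqueness and change of order for the weak Riemann–Liouville derivative -/

theorem HasRightRL.add {s : ℝ} {v v' f f' : ℝ → ℝ} (h : HasRightRL s v f)
    (h' : HasRightRL s v' f') : HasRightRL s (fun x => v x + v' x) (fun x => f x + f' x) := by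
  have hρ : 0 < (⌊s⌋₊ : ℝ) + 1 - s := by linarith [Nat.lt_floor_add_one s]
  refine ⟨fun x hx => (h.1 x hx).add (h'.1 x hx), h.2.1.add h'.2.1, fun φ hφ hc hs => ?_⟩
  have c1 := (contDiff_iteratedDeriv hφ (⌊s⌋₊ + 1)).continuous
  have s1 := (tsupport_iteratedDeriv_subset (φ := φ) (⌊s⌋₊ + 1)).trans hs
  have e : ∫ x in Lam, rightInt ((⌊s⌋₊ : ℝ) + 1 - s) (fun y => v y + v' y) x *
        iteratedDeriv (⌊s⌋₊ + 1) φ x =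
      ∫ x in Lam, rightInt ((⌊s⌋₊ : ℝ) + 1 - s) v x * iteratedDeriv (⌊s⌋₊ + 1) φ x +
        rightInt ((⌊s⌋₊ : ℝ) + 1 - s) v' x * iteratedDeriv (⌊s⌋₊ + 1) φ x := by
    refine integral_congr_ae ?_
    filter_upwards [rightInt_add_ae hρ h.1 h'.1] with x hx
    rw [hx, add_mul]
  rw [e, integral_add
    (integrableOn_mul_of_tsupport_subset (locallyIntegrableOn_rightInt hρ h.1) c1 s1)
    (integrableOn_mul_of_tsupport_subset (locallyIntegrableOn_rightInt hρ h'.1) c1 s1),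
    ← h.2.2 φ hφ hc hs, ← h'.2.2 φ hφ hc hs]
  simp only [add_mul]
  exact integral_add (integrableOn_mul_of_tsupport_subset h.2.1 hφ.continuous hs)
    (integrableOn_mul_of_tsupport_subset h'.2.1 hφ.continuous hs)

theorem HasRightRL.const_mul {s : ℝ} {v f : ℝ → ℝ} (h : HasRightRL s v f) (c : ℝ) :
    HasRightRL s (fun x => c * v x) (fun x => c * f x) := by
  refine ⟨fun x hx => (h.1 x hx).const_mul c, fun x hx => ?_, fun φ hφ hc hs => ?_⟩
  · obtain ⟨t, ht, hi⟩ := h.2.1 x hx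
    exact ⟨t, ht, hi.const_mul c⟩
  · simp only [rightInt_const_mul, mul_assoc, integral_const_mul]
    rw [h.2.2 φ hφ hc hs]

theorem HasRightRL.sub {s : ℝ} {v v' f f' : ℝ → ℝ} (h : HasRightRL s v f)
    (h' : HasRightRL s v' f') : HasRightRL s (fun x => v x - v' x) (fun x => f x - f' x) := by
  simpa [sub_eq_add_neg] using h.add (h'.const_mul (-1))

/-- The fundamental lemma of the calculus of variations; this makes the arbitrary choice in
`rightRL` harmless. -/
theorem HasRightRL.ae_eq {s : ℝ} {v f f' : ℝ → ℝ} (h : HasRightRL s v f)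
    (h' : HasRightRL s v f') : f =ᵐ[volume.restrict Lam] f' := by
  have hl : LocallyIntegrableOn (fun x => f x - f' x) Lam := h.2.1.sub h'.2.1
  have := isOpen_Lam.ae_eq_zero_of_integral_contDiff_smul_eq_zero hl fun φ hφ hc hs => by
    have e : ∫ x, φ x • (f x - f' x) = ∫ x in Lam, f x * φ x - f' x * φ x := by
      rw [setIntegral_eq_integral_of_forall_compl_eq_zero]
      · congr 1; ext x; rw [smul_eq_mul]; ring
      · intro x hx
        rw [image_eq_zero_of_notMem_tsupport fun h => hx (hs h)]
        simp
    rw [e, integral_sub (integrableOn_mul_of_tsupport_subset h.2.1 hφ.continuous hs)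
      (integrableOn_mul_of_tsupport_subset h'.2.1 hφ.continuous hs),
      h.2.2 φ hφ hc hs, h'.2.2 φ hφ hc hs, sub_self]
  rw [EventuallyEq, ae_restrict_iff' measurableSet_Lam]
  filter_upwards [this] with x hx hxm
  exact sub_eq_zero.1 (hx hxm)

theorem hasRightRL_rightRL {s : ℝ} {v : ℝ → ℝ} (h : ∃ f, HasRightRL s v f) :
    HasRightRL s v (rightRL s v) :=
  Classical.epsilon_spec h

/-- Passing from s to s + 1 raises k by one and leaves k - s unchanged, so both derivatives come
from the same fractional integral: test the one of order s with φ'. -/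
theorem HasRightRL.isWeakNegDeriv {s : ℝ} (hs0 : 0 ≤ s) {v f f₁ : ℝ → ℝ} (h : HasRightRL s v f)
    (h₁ : HasRightRL (s + 1) v f₁) : IsWeakNegDeriv f f₁ := by
  intro φ hφ hc hs
  have e := h₁.2.2 φ hφ hc hs
  rw [Nat.floor_add_one hs0, iteratedDeriv_succ'] at e
  have hd : ContDiff ℝ (⊤ : ℕ∞) (deriv φ) := by
    simpa [iteratedDeriv_one] using contDiff_iteratedDeriv hφ 1
  rw [e, h.2.2 (deriv φ) hd hc.deriv (tsupport_deriv_subset.trans hs)]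
  push_cast
  congr 4
  ring_nf

/-! ### The fractional derivative on (1-x)^α times polynomials -/

theorem integral_eval_mul_iteratedDeriv (k : ℕ) :
    ∀ (q : Polynomial ℝ) {φ : ℝ → ℝ}, ContDiff ℝ (⊤ : ℕ∞) φ → tsupport φ ⊆ Lam →
      ∫ x in Lam, q.eval x * iteratedDeriv k φ x =
        (-1) ^ k * ∫ x in Lam, (Polynomial.derivative^[k] q).eval x * φ x := by
  induction k with
  | zero => intro q φ _ _; simp
  | succ k ih =>
    intro q φ hφ hs
    have hs' := (tsupport_iteratedDeriv_subset (φ := φ) k).trans hs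
    rw [iteratedDeriv_succ, integral_Lam_mul_deriv (contDiff_eval q) (contDiff_iteratedDeriv hφ k)
      (hasCompactSupport_of_tsupport_subset hs') hs']
    simp only [Polynomial.deriv]
    rw [ih _ hφ hs, Function.iterate_succ_apply]
    ring

theorem rightInt_one_sub_rpow {σ ρ x : ℝ} (hσ : -1 < σ) (hρ : 0 < ρ) (hx : x < 1) :
    rightInt ρ (fun y => (1 - y) ^ σ) x =
      Real.Gamma (σ + 1) / Real.Gamma (σ + ρ + 1) * (1 - x) ^ (σ + ρ) := by
  unfold rightInt
  rw [integral_one_sub_rpow_mul hσ hρ hx]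
  have := (Real.Gamma_pos_of_pos hρ).ne'
  field_simp

/-- By the Beta integral, the fractional integral of order k - α sends (1-x)^{α+j} to a multiple of
the polynomial (1-x)^{k+j}; the weak derivative is then the classical one. -/
theorem hasRightRL_one_sub_rpow {α : ℝ} (hα : 0 < α) (j : ℕ) :
    HasRightRL α (fun x => (1 - x) ^ α * (1 - x) ^ j)
      (fun x => Real.Gamma (α + j + 1) / j.factorial * (1 - x) ^ j) := by
  have hj : (0 : ℝ) ≤ j := Nat.cast_nonneg j
  refine ⟨fun x hx => ?_, ?_, fun φ hφ hc hs => ?_⟩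
  · have hcont : Continuous fun x : ℝ => (1 - x) ^ α * (1 - x) ^ j :=
      (Continuous.rpow_const (by fun_prop) fun _ => Or.inr hα.le).mul (by fun_prop)
    exact (hcont.integrableOn_Icc (a := x) (b := 1)).mono_set Ioo_subset_Icc_self
  · exact (Continuous.locallyIntegrable (by fun_prop)).locallyIntegrableOn _
  · set k := ⌊α⌋₊ + 1 with hk
    have hρ : 0 < (⌊α⌋₊ : ℝ) + 1 - α := by linarith [Nat.lt_floor_add_one α]
    -- The sign (-1)^(k+j) rewrites (1-x)^(k+j) as a power of X - 1, whose iterated derivatives have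
    -- a closed form.
    set q : Polynomial ℝ := Polynomial.C
      (Real.Gamma (α + j + 1) / (k + j).factorial * (-1) ^ (k + j)) *
        (Polynomial.X - Polynomial.C 1) ^ (k + j) with hq
    have e : ∀ x ∈ Lam, rightInt ((⌊α⌋₊ : ℝ) + 1 - α) (fun x => (1 - x) ^ α * (1 - x) ^ j) x =
        q.eval x := by
      intro x hx
      have hx1 : 0 < 1 - x := by linarith [hx.2]
      have e1 : rightInt ((⌊α⌋₊ : ℝ) + 1 - α) (fun x => (1 - x) ^ α * (1 - x) ^ j) x =
          rightInt ((⌊α⌋₊ : ℝ) + 1 - α) (fun x => (1 - x) ^ (α + j)) x := by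
        unfold rightInt
        congr 1
        refine setIntegral_congr_fun measurableSet_Ioo fun y hy => ?_
        simp only
        rw [Real.rpow_add_natCast (by linarith [hy.2])]
      rw [e1, rightInt_one_sub_rpow (by linarith) hρ hx.2,
        show α + j + ((⌊α⌋₊ : ℝ) + 1 - α) = ((k + j : ℕ) : ℝ) by rw [hk]; push_cast; ring,
        Real.Gamma_nat_eq_factorial, Real.rpow_natCast, hq]
      simp only [Polynomial.eval_mul, Polynomial.eval_C, Polynomial.eval_pow, Polynomial.eval_sub,
        Polynomial.eval_X]
      rw [mul_assoc, ← mul_pow]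
      congr 2
      ring
    have e' : ∫ x in Lam, rightInt ((⌊α⌋₊ : ℝ) + 1 - α)
        (fun x => (1 - x) ^ α * (1 - x) ^ j) x * iteratedDeriv k φ x =
        ∫ x in Lam, q.eval x * iteratedDeriv k φ x :=
      setIntegral_congr_fun measurableSet_Lam fun x hx => by simp only [e x hx]
    rw [e', integral_eval_mul_iteratedDeriv k q hφ hs, ← integral_const_mul]
    congr 1
    ext x
    rw [hq, Polynomial.iterate_derivative_C_mul, Polynomial.iterate_derivative_X_sub_pow,
      Nat.add_sub_cancel_left]
    simp only [Polynomial.eval_mul, Polynomial.eval_C, Polynomial.eval_pow, Polynomial.eval_sub,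
      Polynomial.eval_X, Polynomial.eval_natCast, nsmul_eq_mul]
    have hf : ((k + j).factorial : ℝ) = j.factorial * (k + j).descFactorial k := by
      have := Nat.factorial_mul_descFactorial (Nat.le_add_right k j)
      rw [Nat.add_sub_cancel_left] at this
      exact_mod_cast this.symm
    have h1 : (j.factorial : ℝ) ≠ 0 := by positivity
    have h2 : ((k + j).descFactorial k : ℝ) ≠ 0 := by
      have : 0 < (k + j).descFactorial k := Nat.descFactorial_pos.2 (by omega)
      positivity
    have h3 : ((-1 : ℝ)) ^ k * (-1) ^ k = 1 := by rw [← mul_pow]; simp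
    rw [hf, show (1 - x) ^ j = (-1) ^ j * (x - 1) ^ j by rw [← mul_pow]; ring, pow_add]
    field_simp
    linear_combination (-((-1) ^ j * (x - 1) ^ j * φ x)) * h3

/-- Multiplication of the `j`-th coefficient of a polynomial by `c j`. -/
def coeffScale (c : ℕ → ℝ) : Polynomial ℝ →ₗ[ℝ] Polynomial ℝ :=
  Polynomial.lsum fun j => (Polynomial.monomial j).comp (c j • LinearMap.id)

theorem coeffScale_monomial (c : ℕ → ℝ) (j : ℕ) (a : ℝ) :
    coeffScale c (Polynomial.monomial j a) = Polynomial.monomial j (c j * a) := by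
  simp [coeffScale, Polynomial.sum_monomial_index]

theorem coeff_coeffScale (c : ℕ → ℝ) (A : Polynomial ℝ) (j : ℕ) :
    (coeffScale c A).coeff j = c j * A.coeff j := by
  induction A using Polynomial.induction_on' with
  | add p q hp hq => rw [map_add, Polynomial.coeff_add, hp, hq, Polynomial.coeff_add, mul_add]
  | monomial n a =>
    rw [coeffScale_monomial, Polynomial.coeff_monomial, Polynomial.coeff_monomial]
    split_ifs with h
    · rw [h]
    · simp

theorem natDegree_coeffScale_le (c : ℕ → ℝ) (A : Polynomial ℝ) :
    (coeffScale c A).natDegree ≤ A.natDegree := by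
  refine Polynomial.natDegree_le_iff_coeff_eq_zero.2 fun j hj => ?_
  rw [coeff_coeffScale, Polynomial.coeff_eq_zero_of_natDegree_lt hj, mul_zero]

theorem coeffScale_coeffScale_of_mul_eq_one {c d : ℕ → ℝ} (h : ∀ j, c j * d j = 1)
    (A : Polynomial ℝ) : coeffScale c (coeffScale d A) = A := by
  ext j
  rw [coeff_coeffScale, coeff_coeffScale, ← mul_assoc, h, one_mul]

theorem comp_one_sub_X_comp_one_sub_X (A : Polynomial ℝ) :
    (A.comp (1 - Polynomial.X)).comp (1 - Polynomial.X) = A := by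
  rw [Polynomial.comp_assoc]
  simp

theorem natDegree_comp_one_sub_X_le (A : Polynomial ℝ) :
    (A.comp (1 - Polynomial.X)).natDegree ≤ A.natDegree := by
  have h : (1 - Polynomial.X : Polynomial ℝ).natDegree ≤ 1 :=
    (Polynomial.natDegree_sub_le _ _).trans (by simp)
  exact Polynomial.natDegree_comp_le.trans (by nlinarith)

/-- The factor `Γ(α + j + 1) / j!` by which `D_+^α` maps `(1 - x)^{α + j}` to `(1 - x)^j`. -/
def fracFactor (α : ℝ) (j : ℕ) : ℝ := Real.Gamma (α + j + 1) / j.factorial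

theorem fracFactor_pos {α : ℝ} (hα : 0 < α) (j : ℕ) : 0 < fracFactor α j :=
  div_pos (Real.Gamma_pos_of_pos (by positivity)) (by positivity)

/-- The polynomial `D_+^α ((1 - x)^α ψ)`. -/
def fracDeriv (α : ℝ) (ψ : Polynomial ℝ) : Polynomial ℝ :=
  (coeffScale (fracFactor α) (ψ.comp (1 - Polynomial.X))).comp (1 - Polynomial.X)

theorem hasRightRL_fracDeriv {α : ℝ} (hα : 0 < α) (ψ : Polynomial ℝ) :
    HasRightRL α (fun x => (1 - x) ^ α * ψ.eval x) (fun x => (fracDeriv α ψ).eval x) := by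
  have main : ∀ A : Polynomial ℝ, HasRightRL α (fun x => (1 - x) ^ α * A.eval (1 - x))
      (fun x => (coeffScale (fracFactor α) A).eval (1 - x)) := by
    intro A
    induction A using Polynomial.induction_on' with
    | add p q hp hq => simpa [mul_add] using hp.add hq
    | monomial n a =>
      convert (hasRightRL_one_sub_rpow hα n).const_mul a using 2 with x x
      · simp; ring
      · rw [coeffScale_monomial]
        simp [fracFactor]
        ring
  have h := main (ψ.comp (1 - Polynomial.X))
  simpa [fracDeriv] using h

theorem fracDeriv_injective {α : ℝ} (hα : 0 < α) : Function.Injective (fracDeriv α) := by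
  intro ψ ψ' h
  have h1 := congrArg (fun p : Polynomial ℝ => p.comp (1 - Polynomial.X)) h
  simp only [fracDeriv, comp_one_sub_X_comp_one_sub_X] at h1
  have h2 := congrArg (coeffScale fun j => (fracFactor α j)⁻¹) h1
  have hc : ∀ j, (fracFactor α j)⁻¹ * fracFactor α j = 1 := fun j =>
    inv_mul_cancel₀ (fracFactor_pos hα j).ne'
  rw [coeffScale_coeffScale_of_mul_eq_one hc, coeffScale_coeffScale_of_mul_eq_one hc] at h2
  rw [← comp_one_sub_X_comp_one_sub_X ψ, h2, comp_one_sub_X_comp_one_sub_X]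

/-- In powers of 1 - x the map is diagonal with positive entries, so it is inverted coefficientwise
without raising the degree. -/
theorem exists_fracDeriv_eq {α : ℝ} (hα : 0 < α) (p : Polynomial ℝ) :
    ∃ ψ : Polynomial ℝ, ψ.natDegree ≤ p.natDegree ∧ fracDeriv α ψ = p := by
  refine ⟨(coeffScale (fun j => (fracFactor α j)⁻¹) (p.comp (1 - Polynomial.X))).comp
    (1 - Polynomial.X), ?_, ?_⟩
  · exact (natDegree_comp_one_sub_X_le _).trans
      ((natDegree_coeffScale_le _ _).trans (natDegree_comp_one_sub_X_le _))
  · unfold fracDeriv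
    rw [comp_one_sub_X_comp_one_sub_X, coeffScale_coeffScale_of_mul_eq_one fun j =>
      mul_inv_cancel₀ (fracFactor_pos hα j).ne', comp_one_sub_X_comp_one_sub_X]

/-! ### The projection error -/

theorem IsPolyProj.innerW_sub_le {a b : ℝ} (ha : -1 < a) (hb : -1 < b) {N : ℕ} {f : ℝ → ℝ}
    (hf : MemL2 a b f) {p : Polynomial ℝ} (hp : IsPolyProj a b N f p) :
    innerW a b (fun x => p.eval x - f x) (fun x => p.eval x - f x) ≤ innerW a b f f := by
  have hm := memL2_eval ha hb p
  have h1 := hp.innerW_eval_eq ha hb hf hp.1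
  have h2 := innerW_self_nonneg (a := a) (b := b) fun x => p.eval x
  rw [innerW_sub_left hm hf (hm.sub hf), innerW_sub_right hm hf hm, innerW_sub_right hm hf hf,
    innerW_comm (fun x => p.eval x) f, h1]
  linarith

/-- Step j works in degree N - j = n + 1 with weight (j, γ + j). Its eigenvalue (n + 2)(N + j + 2 +
γ) is at least N(n + 2); the factors n + 2 = N + 1 - j build up the descending factorial. -/
theorem IsPolyProj.exists_iterate {γ : ℝ} (hγ : -1 < γ) {N m : ℕ} (hmN : m ≤ N)
    {f : ℕ → ℝ → ℝ} (hf : ∀ l ≤ m, MemL2 l (γ + l) (f l))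
    (hloc : ∀ l ≤ m, LocallyIntegrableOn (f l) Lam)
    (hw : ∀ l < m, IsWeakNegDeriv (f l) (f (l + 1))) {p : Polynomial ℝ}
    (hp : IsPolyProj 0 γ N (f 0) p) {j : ℕ} (hj : j ≤ m) :
    ∃ q : Polynomial ℝ, IsPolyProj j (γ + j) (N - j) (f j) q ∧
      (N : ℝ) ^ j * (N + 1).descFactorial j *
          innerW 0 γ (fun x => p.eval x - f 0 x) (fun x => p.eval x - f 0 x) ≤
        innerW j (γ + j) (fun x => q.eval x - f j x) (fun x => q.eval x - f j x) := by
  induction j with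
  | zero => exact ⟨p, by simpa using hp, by simp⟩
  | succ j ih =>
    obtain ⟨q, hq, hle⟩ := ih (by omega)
    have hj0 : (0 : ℝ) ≤ j := Nat.cast_nonneg j
    obtain ⟨n, hn⟩ : ∃ n, N - j = n + 1 := ⟨N - j - 1, by omega⟩
    have hN : (N : ℝ) = n + 1 + j := by
      have : N = n + 1 + j := by omega
      rw [this]; push_cast; ring
    rw [hn] at hq
    have hfs := hf (j + 1) hj
    push_cast at hfs ⊢
    rw [← add_assoc] at hfs ⊢
    obtain ⟨h1, h2⟩ := hq.derivative (by linarith) (by linarith) (hf j (by omega)) hfs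
      (hw j (by omega)) (hloc j (by omega)) (hloc (j + 1) hj)
    refine ⟨-q.derivative, by rwa [show N - (j + 1) = n by omega], le_trans ?_ h2⟩
    have hnn := innerW_self_nonneg (a := j) (b := γ + j) fun x => q.eval x - f j x
    have heig : (N : ℝ) * (n + 2) ≤ jacobiEig j (γ + j) (n + 2) := by
      unfold jacobiEig
      push_cast
      rw [mul_comm, hN]
      exact mul_le_mul_of_nonneg_left (by linarith) (by positivity)
    have hdesc : ((N + 1).descFactorial (j + 1) : ℝ) = (n + 2) * (N + 1).descFactorial j := by
      rw [Nat.descFactorial_succ, show N + 1 - j = n + 2 by omega]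
      push_cast; ring
    calc (N : ℝ) ^ (j + 1) * (N + 1).descFactorial (j + 1) *
          innerW 0 γ (fun x => p.eval x - f 0 x) (fun x => p.eval x - f 0 x)
        = N * (n + 2) * ((N : ℝ) ^ j * (N + 1).descFactorial j *
          innerW 0 γ (fun x => p.eval x - f 0 x) (fun x => p.eval x - f 0 x)) := by
          rw [hdesc]; ring
      _ ≤ N * (n + 2) *
          innerW j (γ + j) (fun x => q.eval x - f j x) (fun x => q.eval x - f j x) :=
          mul_le_mul_of_nonneg_left hle (by positivity)
      _ ≤ _ := mul_le_mul_of_nonneg_right heig hnn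

/-! ### Constants and the projection π_N -/

theorem sqrt_le_mul_sqrt_of_sq_mul_eq_one {K D E R : ℝ} (hK : 0 ≤ K) (hKD : K ^ 2 * D = 1)
    (hR : 0 ≤ R) (h : D * E ≤ R) : Real.sqrt E ≤ K * Real.sqrt R := by
  refine Real.sqrt_le_iff.2 ⟨by positivity, ?_⟩
  rw [mul_pow, Real.sq_sqrt hR]
  calc E = K ^ 2 * (D * E) := by rw [← mul_assoc, hKD, one_mul]
    _ ≤ K ^ 2 * R := mul_le_mul_of_nonneg_left h (sq_nonneg _)

/-- For fixed m the quotient is a product of m factors N/(N+1-i), each tending to 1. -/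
theorem tendsto_sqrt_pow_div_descFactorial (m : ℕ) :
    Tendsto (fun N : ℕ => Real.sqrt ((N : ℝ) ^ m / (N + 1).descFactorial m)) atTop (𝓝 1) := by
  have h : Tendsto (fun N : ℕ => ∏ i ∈ Finset.range m, (N : ℝ) / ((N + 1 - i : ℕ) : ℝ)) atTop
      (𝓝 (∏ _i ∈ Finset.range m, (1 : ℝ))) := by
    refine tendsto_finsetProd _ fun i _ => ?_
    refine (tendsto_natCast_div_add_atTop (1 - (i : ℝ))).congr' ?_
    filter_upwards [eventually_ge_atTop i] with N hN
    rw [Nat.cast_sub (by omega)]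
    push_cast
    congr 1; ring
  rw [Finset.prod_const_one] at h
  have h2 := h.sqrt
  rw [Real.sqrt_one] at h2
  refine h2.congr fun N => ?_
  rw [Finset.prod_div_distrib, Finset.prod_const, Finset.card_range,
    Nat.descFactorial_eq_prod_range]
  push_cast
  rfl

theorem descFactorial_succ_eq_div {m N : ℕ} (h : m ≤ N) :
    ((N - m + 1).factorial : ℝ) / (N + 1).factorial = ((N + 1).descFactorial m : ℝ)⁻¹ := by
  have h1 := Nat.factorial_mul_descFactorial (show m ≤ N + 1 by omega)
  rw [show N + 1 - m = N - m + 1 by omega] at h1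
  rw [← h1]
  have : ((N - m + 1).factorial : ℝ) ≠ 0 := by positivity
  push_cast
  field_simp

/-- The polynomial projection is unique, polynomials equal a.e. on Λ coincide, and `fracDeriv` is
injective; so ψ, and with it the function at every real point, is determined. -/
theorem existsUnique_isFracProj {α β : ℝ} (hα : 0 < α) (hγ : -1 < α + β) (N : ℕ) {u : ℝ → ℝ}
    (hu : MemL2 0 (α + β) (rightRL α u)) : ∃! w : ℝ → ℝ, IsFracProj α β N u w := by
  obtain ⟨p, hp⟩ := exists_isPolyProj (by norm_num) hγ N hu
  obtain ⟨ψ, hψ, hψp⟩ := exists_fracDeriv_eq hα p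
  refine ⟨fun x => (1 - x) ^ α * ψ.eval x,
    ⟨⟨ψ, hψ.trans hp.1, rfl⟩, p, hp, hψp ▸ hasRightRL_fracDeriv hα ψ⟩, ?_⟩
  rintro w ⟨⟨ψ', -, rfl⟩, p', hp', hw⟩
  have h1 : p' = p := hp'.unique (by norm_num) hγ hu hp
  have h2 : fracDeriv α ψ' = p' :=
    polynomial_eq_of_ae_eq ((hasRightRL_fracDeriv hα ψ').ae_eq hw)
  rw [fracDeriv_injective hα (h2.trans (h1.trans hψp.symm))]

end GJF

end

open GJF MeasureTheory

theorem theorem4p2 (m : ℕ) :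
    ∃ c : ℕ → ℝ, Filter.Tendsto c Filter.atTop (nhds 1) ∧
      ∀ α β : ℝ, 0 < α → -α - 1 < β → β < -1 → (∀ k : ℕ, -β ≠ (k : ℝ)) →
      ∀ N : ℕ, m ≤ N → ∀ u : ℝ → ℝ,
        (∀ l : ℕ, l ≤ m → GJF.RightRLMemL2 (α + l) l (α + β + l) u) →
        (∃! w : ℝ → ℝ, GJF.IsFracProj α β N u w) ∧
        ∀ w : ℝ → ℝ, GJF.IsFracProj α β N u w →
          GJF.RightRLMemL2 α 0 (α + β) (fun x => w x - u x) ∧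
          GJF.normW 0 (α + β) (GJF.rightRL α (fun x => w x - u x)) ≤
            (N : ℝ) ^ (-(m : ℝ) / 2) *
              Real.sqrt (((N - m + 1).factorial : ℝ) / ((N + 1).factorial : ℝ)) *
              GJF.normW m (α + β + m) (GJF.rightRL (α + m) u) ∧
          GJF.normW 0 (α + β) (GJF.rightRL α (fun x => w x - u x)) ≤
            c N * (N : ℝ) ^ (-(m : ℝ)) *
              GJF.normW m (α + β + m) (GJF.rightRL (α + m) u) := by
  -- Chosen so that c_N N^{-m} is the constant of the first estimate: both squares are the inverse
  -- of N^m (N+1)!/(N-m+1)!.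
  refine ⟨fun N => Real.sqrt ((N : ℝ) ^ m / (N + 1).descFactorial m),
    tendsto_sqrt_pow_div_descFactorial m, ?_⟩
  intro α β hα hβ _ _ N hmN u hu
  have hγ : -1 < α + β := by linarith
  have hu0 : RightRLMemL2 α 0 (α + β) u := by simpa using hu 0 (Nat.zero_le m)
  refine ⟨existsUnique_isFracProj hα hγ N hu0.2, ?_⟩
  rintro w ⟨-, p, hp, hwp⟩
  have hRL : ∀ l ≤ m, HasRightRL (α + l) u (rightRL (α + l) u) := fun l hl =>
    hasRightRL_rightRL (hu l hl).1
  have hdiff : HasRightRL α (fun x => w x - u x) (fun x => p.eval x - rightRL α u x) :=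
    hwp.sub (hasRightRL_rightRL hu0.1)
  have hae := (hasRightRL_rightRL ⟨_, hdiff⟩).ae_eq hdiff
  have hmem : MemL2 0 (α + β) (fun x => p.eval x - rightRL α u x) :=
    (memL2_eval (by norm_num) hγ p).sub hu0.2
  obtain ⟨q, hq, hle⟩ := IsPolyProj.exists_iterate hγ hmN (f := fun l => rightRL (α + l) u)
    (fun l hl => (hu l hl).2) (fun l hl => (hRL l hl).2.1)
    (fun l hl => by
      refine (hRL l hl.le).isWeakNegDeriv (by positivity) ?_
      have := hRL (l + 1) hl
      push_cast at this ⊢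
      rwa [← add_assoc] at this ⊢)
    (p := p) (by simpa using hp) le_rfl
  have hm0 : (0 : ℝ) ≤ m := Nat.cast_nonneg m
  -- At level m the projection error is bounded by the norm of the function itself.
  have hle' := hle.trans (hq.innerW_sub_le (by linarith) (by linarith) (hu m le_rfl).2)
  simp only [Nat.cast_zero, add_zero] at hle'
  rw [← innerW_congr hae hae] at hle'
  have hR := innerW_self_nonneg (a := m) (b := α + β + m) (rightRL (α + m) u)
  -- N = 0 is possible only for m = 0, where 0^0 = 1.
  have hN : (N : ℝ) ^ m ≠ 0 := by
    rcases Nat.eq_zero_or_pos m with rfl | h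
    · simp
    · have : 0 < N := by omega
      positivity
  have hd : ((N + 1).descFactorial m : ℝ) ≠ 0 := by
    exact_mod_cast (Nat.descFactorial_pos.2 (show m ≤ N + 1 by omega)).ne'
  have hneg : (N : ℝ) ^ (-(m : ℝ)) = ((N : ℝ) ^ m)⁻¹ := by
    rw [Real.rpow_neg (Nat.cast_nonneg N), Real.rpow_natCast]
  refine ⟨⟨⟨_, hdiff⟩, ?_⟩, ?_, ?_⟩
  · rw [memL2_iff] at hmem ⊢
    exact hmem.ae_eq ((withDensity_absolutelyContinuous _ _).ae_le hae.symm)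
  · refine sqrt_le_mul_sqrt_of_sq_mul_eq_one (by positivity) ?_ hR hle'
    rw [mul_pow, Real.sq_sqrt (by positivity), descFactorial_succ_eq_div hmN,
      ← Real.rpow_mul_natCast (Nat.cast_nonneg N)]
    push_cast
    rw [div_mul_cancel₀ _ (two_ne_zero' ℝ), hneg]
    field_simp
  · refine sqrt_le_mul_sqrt_of_sq_mul_eq_one (by positivity) ?_ hR hle'
    rw [mul_pow, Real.sq_sqrt (by positivity), hneg]
    field_simp
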